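/- Let $n\ge 6$ be an even integer, and let $K\subset\mathbb{R}^2$ be a convex polygon (the convex hull of finitely many points, with non-empty interior) that is symmetric with respect to the origin $o$ and has at most $n$ vertices. Let $V$ denote area and let $K^*=\{y\in\mathbb{R}^2:\langle x,y\rangle\le 1\text{ for all }x\in K\}$ be the polar of $K$. Then $$V(K)\,V(K^*)\le n^2\sin^2\frac{\pi}{n},$$ with equality if and only if $K$ is the image of a regular $n$-gon under an invertible linear map of $\mathbb{R}^2$. -/

import Mathlib

/-- A convex polygon in the Euclidean plane: the convex hull of finitely many points,
with non-empty interior. -/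
def IsConvexPolygon (K : Set (EuclideanSpace ℝ (Fin 2))) : Prop :=
  (∃ S : Set (EuclideanSpace ℝ (Fin 2)), S.Finite ∧ K = convexHull ℝ S) ∧ (interior K).Nonempty

/-- The vertices of a convex polygon are its extreme points. -/
def polygonVertices (K : Set (EuclideanSpace ℝ (Fin 2))) : Set (EuclideanSpace ℝ (Fin 2)) :=
  Set.extremePoints ℝ K

/-- Symmetry with respect to the origin. -/
def IsOriginSymmetric (K : Set (EuclideanSpace ℝ (Fin 2))) : Prop :=
  ∀ x ∈ K, -x ∈ K

/-- The polar set with respect to the origin. -/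
def polarBody (K : Set (EuclideanSpace ℝ (Fin 2))) : Set (EuclideanSpace ℝ (Fin 2)) :=
  {y | ∀ x ∈ K, inner ℝ x y ≤ 1}

/-- A regular `n`-gon: the convex hull of `n` equally spaced points on a circle with
centre `c` and radius `r > 0`. -/
def IsRegularPolygon (n : ℕ) (P : Set (EuclideanSpace ℝ (Fin 2))) : Prop :=
  3 ≤ n ∧ ∃ (c : EuclideanSpace ℝ (Fin 2)) (r θ : ℝ), 0 < r ∧
    P = convexHull ℝ (Set.range fun k : Fin n =>
      c + r • !₂[Real.cos (θ + 2 * Real.pi * (k : ℝ) / (n : ℝ)),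
                 Real.sin (θ + 2 * Real.pi * (k : ℝ) / (n : ℝ))])

/-! Write n = 2N and let `v 0, …, v (m - 1)`, with m ≤ N, be half of the vertices in cyclic order,
continued by `v (i + m) = -v i`. Put D_i = det(v_i, v_{i+1}), let w_i be the polar vertex dual to
the edge from v_i to v_{i+1}, and put q_i = det(w_i, w_{i+1}). Cutting both bodies into triangles at
the origin gives V(K) = S = ∑ D_i and V(K*) = Q = ∑ q_i, sums over i < m. The upper bound needs only
"≤" here (`volume_hull_le`, `volume_polar_le`).

Every linear functional l of the vertices solves the discrete Sturm–Liouville equation Δ(Δl/D) = -q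
l (`dualVertex_recurrence`). Since det(v_0, ·) is a solution positive strictly between the indices 0
and m, Picone's identity gives ∑ ((Δf)²/D_i - q_i f_{i+1}²) ≥ 0 for antiperiodic f, and vanishing
forces f to be a linear functional (`wirtinger`).

Test this with f = cos θ_i and f = sin θ_i, where the steps of θ are 2ψ_i, sin ψ_i = c D_i, and c is
chosen so that ∑ ψ_i = π/2. Adding the two inequalities gives Q ≤ 4c²S, so SQ ≤ (2cS)² = (2 ∑ sin
ψ_i)², and Jensen bounds this by (2N sin(π/2N))² (`sum_mul_sum_le`).

Equality forces m = N, equal angles, and cos and sin linear in the vertices, so a linear map carries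
K to a regular polygon (`exists_regular_of_linear`). Conversely the product is linearly invariant,
and disjoint triangles give the lower bound for the regular polygon (`regular_image_bound`). -/

open Finset MeasureTheory

/-! ### Determinants, symmetric cycles and dual vertices -/

/-- The Euclidean plane. -/
abbrev Plane := EuclideanSpace ℝ (Fin 2)

/-- The determinant of two plane vectors. -/
def planeDet (a b : Plane) : ℝ := a 0 * b 1 - a 1 * b 0

lemma planeDet_swap (a b : Plane) : planeDet a b = -planeDet b a := by unfold planeDet; ring

@[simp] lemma planeDet_self (a : Plane) : planeDet a a = 0 := by unfold planeDet; ring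

@[simp] lemma planeDet_neg_left (a b : Plane) : planeDet (-a) b = -planeDet a b := by
  simp [planeDet]; ring

@[simp] lemma planeDet_neg_right (a b : Plane) : planeDet a (-b) = -planeDet a b := by
  simp [planeDet]; ring

lemma planeDet_smul_left (t : ℝ) (a b : Plane) : planeDet (t • a) b = t * planeDet a b := by
  simp [planeDet]; ring

lemma planeDet_smul_right (t : ℝ) (a b : Plane) : planeDet a (t • b) = t * planeDet a b := by
  simp [planeDet]; ring

lemma planeDet_add_right (a b c : Plane) : planeDet a (b + c) = planeDet a b + planeDet a c := by
  simp [planeDet]; ring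

lemma planeDet_add_left (a b c : Plane) : planeDet (a + b) c = planeDet a c + planeDet b c := by
  simp [planeDet]; ring

lemma planeDet_plucker (a b c d : Plane) :
    planeDet a b * planeDet c d - planeDet a c * planeDet b d + planeDet a d * planeDet b c = 0 := by
  unfold planeDet; ring

lemma planeDet_smul_eq (a b x : Plane) :
    planeDet a b • x = planeDet x b • a + planeDet a x • b := by
  ext i; fin_cases i <;> simp [planeDet] <;> ring

lemma eq_combination {a b : Plane} (h : planeDet a b ≠ 0) (x : Plane) :
    x = (planeDet x b / planeDet a b) • a + (planeDet a x / planeDet a b) • b := by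
  have := congrArg ((planeDet a b)⁻¹ • ·) (planeDet_smul_eq a b x)
  simp only [smul_smul, smul_add, inv_mul_cancel₀ h, one_smul] at this
  rw [div_eq_inv_mul, div_eq_inv_mul]; exact this

lemma inner_plane (x y : Plane) : inner ℝ x y = x 0 * y 0 + x 1 * y 1 := by
  simp [PiLp.inner_apply, Fin.sum_univ_two, mul_comm]

/-- Half a turn's worth `v 0, …, v (m - 1)` of vertices of an origin symmetric polygon in
counterclockwise order, extended antiperiodically. -/
structure IsSymmetricCycle (m : ℕ) (v : ℕ → Plane) : Prop where
  two_le : 2 ≤ m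
  anti : ∀ i, v (i + m) = -v i
  planeDet_pos : ∀ i j, i < j → j < i + m → 0 < planeDet (v i) (v j)

/-- The vector pairing to `1` with `a` and `b`. -/
noncomputable def dualVertex (a b : Plane) : Plane :=
  (planeDet a b)⁻¹ • !₂[b 1 - a 1, a 0 - b 0]

/-- The vertices of the polar polygon. -/
noncomputable def dualCycle (v : ℕ → Plane) (i : ℕ) : Plane := dualVertex (v i) (v (i + 1))

lemma inner_dualVertex (a b x : Plane) :
    inner ℝ x (dualVertex a b) = (planeDet a x + planeDet x b) / planeDet a b := by
  rw [inner_plane]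
  simp only [dualVertex, PiLp.smul_apply, smul_eq_mul, div_eq_inv_mul]
  simp [planeDet]; ring

lemma planeDet_dualVertex (a b c : Plane) :
    planeDet (dualVertex a b) (dualVertex b c) =
      (planeDet a b + planeDet b c - planeDet a c) / (planeDet a b * planeDet b c) := by
  rw [dualVertex, dualVertex, planeDet_smul_left, planeDet_smul_right, div_eq_inv_mul, mul_inv, mul_assoc]
  simp [planeDet]; left; left; ring

lemma dualVertex_neg (a b : Plane) : dualVertex (-a) (-b) = -dualVertex a b := by
  rw [dualVertex, dualVertex, planeDet_neg_left, planeDet_neg_right, neg_neg, ← smul_neg]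
  congr 1
  ext i; fin_cases i <;> simp <;> ring

/-- A dual vertex is the edge vector divided by its determinant, turned by a right angle. Both dual
vertices pair to 1 with `b`, so their difference is orthogonal to `b`; turned back, it is a multiple
of `b`. Applying the functional with coefficients `s`, `t` gives the recurrence. -/
lemma dualVertex_recurrence {a b c : Plane} (hab : planeDet a b ≠ 0) (hbc : planeDet b c ≠ 0)
    (s t : ℝ) :
    ((s * c 0 + t * c 1) - (s * b 0 + t * b 1)) / planeDet b c
      - ((s * b 0 + t * b 1) - (s * a 0 + t * a 1)) / planeDet a b
      = -(planeDet (dualVertex a b) (dualVertex b c) * (s * b 0 + t * b 1)) := by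
  rw [planeDet_dualVertex]
  field_simp
  unfold planeDet; ring

lemma sum_by_parts (P h : ℕ → ℝ) (m : ℕ) :
    ∑ i ∈ range m, (P i * (h (i + 1) - h i) + (P (i + 1) - P i) * h (i + 1))
      = P m * h m - P 0 * h 0 := by
  rw [← Finset.sum_range_sub (fun i => P i * h i)]
  exact Finset.sum_congr rfl fun i _ => by ring

/-! ### The discrete Wirtinger inequality -/

namespace IsSymmetricCycle

variable {m : ℕ} {v : ℕ → Plane}

lemma planeDet_succ_pos (hv : IsSymmetricCycle m v) (i : ℕ) : 0 < planeDet (v i) (v (i + 1)) :=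
  hv.planeDet_pos i (i + 1) (by omega) (by have := hv.two_le; omega)

lemma dual_anti (hv : IsSymmetricCycle m v) (i : ℕ) : dualCycle v (i + m) = -dualCycle v i := by
  rw [dualCycle, hv.anti, show i + m + 1 = i + 1 + m by omega, hv.anti, dualVertex_neg, dualCycle]

lemma planeDet_succ_add (hv : IsSymmetricCycle m v) (i : ℕ) :
    planeDet (v (i + m)) (v (i + m + 1)) = planeDet (v i) (v (i + 1)) := by
  rw [show i + m + 1 = i + 1 + m by omega, hv.anti, hv.anti]; simp

/-- The quadratic form is unchanged when a linear functional of the vertices is added. -/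
lemma form_add_linear (hv : IsSymmetricCycle m v) (s t : ℝ) {g : ℕ → ℝ}
    (hg : g m = -g 0) :
    ∑ i ∈ range m, (((g (i + 1) + (s * v (i + 1) 0 + t * v (i + 1) 1))
          - (g i + (s * v i 0 + t * v i 1))) ^ 2 / planeDet (v i) (v (i + 1))
        - planeDet (dualCycle v i) (dualCycle v (i + 1))
          * (g (i + 1) + (s * v (i + 1) 0 + t * v (i + 1) 1)) ^ 2) =
    ∑ i ∈ range m, ((g (i + 1) - g i) ^ 2 / planeDet (v i) (v (i + 1))
        - planeDet (dualCycle v i) (dualCycle v (i + 1)) * g (i + 1) ^ 2) := by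
  set l : ℕ → ℝ := fun i => s * v i 0 + t * v i 1 with hl
  set P : ℕ → ℝ := fun i => (l (i + 1) - l i) / planeDet (v i) (v (i + 1)) with hP
  have hrec : ∀ i, P (i + 1) - P i
      = -(planeDet (dualCycle v i) (dualCycle v (i + 1)) * l (i + 1)) := fun i =>
    dualVertex_recurrence (hv.planeDet_succ_pos i).ne' (hv.planeDet_succ_pos (i + 1)).ne' s t
  have hlm : ∀ i, l (i + m) = -l i := fun i => by simp [hl, hv.anti]; ring
  have hPm : P m = -P 0 := by
    have h1 := hlm 0
    have h2 := hlm 1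
    have h3 := hv.planeDet_succ_add 0
    simp only [zero_add] at h1 h2 h3
    simp only [hP, zero_add]
    rw [h3, add_comm m 1, h2, h1]; ring
  -- Adding `l` changes the squares by `l (2 g + l)`-type terms, which telescope against `P`. Both
  -- factors are antiperiodic, so the boundary terms cancel.
  have hkey := sum_by_parts P (fun i => 2 * g i + l i) m
  have hlm0 := hlm 0
  rw [zero_add] at hlm0
  rw [hPm, hg, hlm0] at hkey
  have h0 : -P 0 * (2 * -g 0 + -l 0) - P 0 * (2 * g 0 + l 0) = 0 := by ring
  rw [h0] at hkey
  rw [← sub_eq_zero, ← Finset.sum_sub_distrib, ← hkey]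
  refine Finset.sum_congr rfl fun i _ => ?_
  rw [hrec]
  simp only [hP]
  change ((g (i + 1) + l (i + 1)) - (g i + l i)) ^ 2 / _ - _ * (g (i + 1) + l (i + 1)) ^ 2 - _ = _
  ring

/-- Picone's identity for sequences vanishing at both ends. -/
lemma picone (hv : IsSymmetricCycle m v) {g : ℕ → ℝ} (h0 : g 0 = 0) (hm : g m = 0) :
    ∑ i ∈ range m, ((g (i + 1) - g i) ^ 2 / planeDet (v i) (v (i + 1))
        - planeDet (dualCycle v i) (dualCycle v (i + 1)) * g (i + 1) ^ 2) =
    ∑ i ∈ range m, planeDet (v 0) (v i) * planeDet (v 0) (v (i + 1)) / planeDet (v i) (v (i + 1)) *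
      (g (i + 1) / planeDet (v 0) (v (i + 1)) - g i / planeDet (v 0) (v i)) ^ 2 := by
  set y : ℕ → ℝ := fun i => planeDet (v 0) (v i) with hy
  -- At 0 and `m` this is 0/0 = 0, which is harmless: `g = y r` still holds there because `g`
  -- vanishes.
  set r : ℕ → ℝ := fun i => g i / y i with hr
  have hgr : ∀ i ≤ m, g i = y i * r i := by
    intro i hi
    rcases Nat.eq_zero_or_pos i with rfl | hpos
    · simp [h0, hr]
    rcases hi.eq_or_lt with rfl | hlt
    · simp [hm, hr]
    · have : y i ≠ 0 := (hv.planeDet_pos 0 i hpos (by omega)).ne'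
      simp only [hr]; field_simp
  set P : ℕ → ℝ := fun i => (y (i + 1) - y i) / planeDet (v i) (v (i + 1)) with hP
  have hrec : ∀ i, P (i + 1) - P i
      = -(planeDet (dualCycle v i) (dualCycle v (i + 1)) * y (i + 1)) := fun i => by
    -- These coefficients are those of the functional det(v_0, ·).
    have := dualVertex_recurrence (hv.planeDet_succ_pos i).ne' (hv.planeDet_succ_pos (i + 1)).ne'
      (-(v 0 1)) (v 0 0)
    have hyl : ∀ j, y j = -(v 0 1) * v j 0 + v 0 0 * v j 1 := fun j => by
      simp only [hy, planeDet]; ring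
    simp only [hP, hyl]
    exact this
  have hkey := sum_by_parts P (fun i => g i * r i) m
  simp only [h0, hm, zero_mul, mul_zero, sub_zero] at hkey
  rw [← sub_eq_zero, ← Finset.sum_sub_distrib, ← hkey]
  refine Finset.sum_congr rfl fun i hi => ?_
  rw [hrec]
  have hi := Finset.mem_range.1 hi
  change _ - _ - y i * y (i + 1) / _ * (r (i + 1) - r i) ^ 2 = _
  rw [hgr i hi.le, hgr (i + 1) hi]
  simp only [hP]
  ring

lemma picone_nonneg (hv : IsSymmetricCycle m v) (r : ℕ → ℝ) {i : ℕ} (hi : i < m) :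
    0 ≤ planeDet (v 0) (v i) * planeDet (v 0) (v (i + 1)) / planeDet (v i) (v (i + 1)) * (r i) ^ 2 := by
  have h : ∀ j ≤ m, 0 ≤ planeDet (v 0) (v j) := by
    intro j hj
    rcases Nat.eq_zero_or_pos j with rfl | hpos
    · rw [planeDet_self]
    rcases hj.eq_or_lt with rfl | hlt
    · have := hv.anti 0
      rw [zero_add] at this
      rw [this, planeDet_neg_right, planeDet_self, neg_zero]
    · exact (hv.planeDet_pos 0 j hpos (by omega)).le
  have := h i hi.le
  have := h (i + 1) hi
  have := hv.planeDet_succ_pos i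
  positivity

lemma exists_linear_zero (hv : IsSymmetricCycle m v) (a : ℝ) :
    ∃ s t : ℝ, s * v 0 0 + t * v 0 1 = a := by
  have h := hv.planeDet_succ_pos 0
  by_cases h0 : v 0 0 = 0
  · have h1 : v 0 1 ≠ 0 := by
      intro h1; simp [planeDet, h0, h1] at h
    exact ⟨0, a / v 0 1, by field_simp; ring⟩
  · exact ⟨a / v 0 0, 0, by field_simp; ring⟩

/-- The discrete Wirtinger inequality of the cycle, with the equality case. -/
theorem wirtinger (hv : IsSymmetricCycle m v) {f : ℕ → ℝ} (hf : f m = -f 0) :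
    0 ≤ ∑ i ∈ range m, ((f (i + 1) - f i) ^ 2 / planeDet (v i) (v (i + 1))
        - planeDet (dualCycle v i) (dualCycle v (i + 1)) * f (i + 1) ^ 2) ∧
    (∑ i ∈ range m, ((f (i + 1) - f i) ^ 2 / planeDet (v i) (v (i + 1))
        - planeDet (dualCycle v i) (dualCycle v (i + 1)) * f (i + 1) ^ 2) = 0 →
      ∃ s t : ℝ, ∀ i ≤ m, f i = s * v i 0 + t * v i 1) := by
  -- Subtracting a functional that agrees with `f` at `v 0` leaves the form unchanged; by
  -- antiperiodicity the remainder vanishes at both ends, as Picone requires.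
  obtain ⟨s, t, hst⟩ := hv.exists_linear_zero (f 0)
  set g : ℕ → ℝ := fun i => f i - (s * v i 0 + t * v i 1) with hg
  have hvm := hv.anti 0
  rw [zero_add] at hvm
  have hg0 : g 0 = 0 := by simp [hg, hst]
  have hgm : g m = 0 := by
    simp only [hg, hf, hvm, PiLp.neg_apply, ← hst]; ring
  have hfg : ∀ i, f i = g i + (s * v i 0 + t * v i 1) := fun i => by simp [hg]
  simp only [hfg]
  rw [hv.form_add_linear s t (by rw [hg0, hgm, neg_zero]), hv.picone hg0 hgm]
  have hnn := fun i (hi : i ∈ range m) => hv.picone_nonneg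
    (fun i => g (i + 1) / planeDet (v 0) (v (i + 1)) - g i / planeDet (v 0) (v i)) (Finset.mem_range.1 hi)
  refine ⟨Finset.sum_nonneg hnn, fun h => ?_⟩
  rw [Finset.sum_eq_zero_iff_of_nonneg hnn] at h
  -- The Picone weights are positive only when both indices are interior, so the quotient is
  -- constant on 1, …, m - 1.
  have hstep : ∀ i, 1 ≤ i → i < m → g i / planeDet (v 0) (v i) = g 1 / planeDet (v 0) (v 1) := by
    intro i hi
    induction i, hi using Nat.le_induction with
    | base => intro _; rfl
    | succ k hk ih =>
      intro hkm
      rw [← ih (by omega)]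
      have hz := h k (Finset.mem_range.2 (by omega))
      have h1 := hv.planeDet_pos 0 k (by omega) (by omega)
      have h2 := hv.planeDet_pos 0 (k + 1) (by omega) (by omega)
      have h3 := hv.planeDet_succ_pos k
      have h4 : planeDet (v 0) (v k) * planeDet (v 0) (v (k + 1)) / planeDet (v k) (v (k + 1)) ≠ 0 := by
        positivity
      have h5 := (mul_eq_zero.1 hz).resolve_left h4
      exact sub_eq_zero.1 (pow_eq_zero_iff two_ne_zero |>.1 h5)
  set ρ := g 1 / planeDet (v 0) (v 1)
  refine ⟨s - ρ * v 0 1, t + ρ * v 0 0, fun i hi => ?_⟩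
  have hgi : g i = ρ * planeDet (v 0) (v i) := by
    rcases Nat.eq_zero_or_pos i with rfl | hpos
    · rw [hg0, planeDet_self, mul_zero]
    rcases hi.eq_or_lt with rfl | hlt
    · rw [hgm, hvm, planeDet_neg_right, planeDet_self, neg_zero, mul_zero]
    · rw [← hstep i hpos hlt]
      have := (hv.planeDet_pos 0 i hpos (by omega)).ne'
      field_simp
  rw [hgi, planeDet]; ring

end IsSymmetricCycle

/-! ### Areas as sums of triangles -/

/-- The open standard triangle. -/
def openTriangle : Set Plane := {x | 0 < x 0 ∧ 0 < x 1 ∧ x 0 + x 1 < 1}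

/-- The closed standard triangle. -/
def closedTriangle : Set Plane := {x | 0 ≤ x 0 ∧ 0 ≤ x 1 ∧ x 0 + x 1 ≤ 1}

lemma measurePreserving_coords :
    MeasurePreserving (fun x : Plane => (x 0, x 1)) volume (volume : Measure (ℝ × ℝ)) :=
  (volume_preserving_finTwoArrow ℝ).comp (PiLp.volume_preserving_ofLp (Fin 2))

lemma integral_Ioo_one_sub : ∫ x in Set.Ioo (0 : ℝ) 1, (1 - x) = 1 / 2 := by
  rw [← integral_Ioc_eq_integral_Ioo, ← intervalIntegral.integral_of_le zero_le_one]
  rw [intervalIntegral.integral_comp_sub_left (fun x => x)]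
  simp

lemma volume_openTriangle : volume openTriangle = ENNReal.ofReal (1 / 2) := by
  have h : openTriangle = (fun x : Plane => (x 0, x 1)) ⁻¹'
      regionBetween (fun _ => (0 : ℝ)) (fun x => 1 - x) (Set.Ioo 0 1) := by
    ext x
    simp only [openTriangle, regionBetween, Set.mem_ofPred_eq, Set.mem_preimage, Set.mem_Ioo]
    constructor
    · rintro ⟨h0, h1, h2⟩; exact ⟨⟨h0, by linarith⟩, h1, by linarith⟩
    · rintro ⟨⟨h0, _⟩, h1, h2⟩; exact ⟨h0, h1, by linarith⟩
  have hc : ContinuousOn (fun x : ℝ => 1 - x) (Set.Icc 0 1) := by fun_prop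
  have hm : MeasurableSet (regionBetween (fun _ => (0 : ℝ)) (fun x => 1 - x) (Set.Ioo 0 1)) :=
    measurableSet_regionBetween (by fun_prop) (by fun_prop) measurableSet_Ioo
  rw [h, measurePreserving_coords.measure_preimage hm.nullMeasurableSet]
  rw [Measure.volume_eq_prod, volume_regionBetween_eq_integral (by simp)
    ((hc.integrableOn_Icc).mono_set Set.Ioo_subset_Icc_self) measurableSet_Ioo
    (fun x hx => by simpa using hx.2.le)]
  simp only [Pi.sub_apply, sub_zero]
  rw [integral_Ioo_one_sub]

lemma volume_closedTriangle : volume closedTriangle = ENNReal.ofReal (1 / 2) := by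
  have h : closedTriangle = (fun x : Plane => (x 0, x 1)) ⁻¹'
      {p : ℝ × ℝ | 0 ≤ p.1 ∧ 0 ≤ p.2 ∧ p.1 + p.2 ≤ 1} := rfl
  have hm : MeasurableSet {p : ℝ × ℝ | 0 ≤ p.1 ∧ 0 ≤ p.2 ∧ p.1 + p.2 ≤ 1} := by
    measurability
  rw [h, measurePreserving_coords.measure_preimage hm.nullMeasurableSet, Measure.volume_eq_prod,
    Measure.prod_apply hm]
  have hs : ∀ x : ℝ, volume (Prod.mk x ⁻¹' {p : ℝ × ℝ | 0 ≤ p.1 ∧ 0 ≤ p.2 ∧ p.1 + p.2 ≤ 1})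
      = (Set.Icc 0 1).indicator (fun x => ENNReal.ofReal (1 - x)) x := by
    intro x
    by_cases hx : x ∈ Set.Icc (0 : ℝ) 1
    · rw [Set.indicator_of_mem hx]
      have : (Prod.mk x ⁻¹' {p : ℝ × ℝ | 0 ≤ p.1 ∧ 0 ≤ p.2 ∧ p.1 + p.2 ≤ 1})
          = Set.Icc 0 (1 - x) := by
        ext y
        simp only [Set.mem_preimage, Set.mem_ofPred_eq, Set.mem_Icc]
        constructor
        · rintro ⟨_, h1, h2⟩; exact ⟨h1, by linarith⟩
        · rintro ⟨h1, h2⟩; exact ⟨hx.1, h1, by linarith⟩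
      rw [this, Real.volume_Icc, sub_zero]
    · rw [Set.indicator_of_notMem hx]
      have : (Prod.mk x ⁻¹' {p : ℝ × ℝ | 0 ≤ p.1 ∧ 0 ≤ p.2 ∧ p.1 + p.2 ≤ 1}) = ∅ := by
        ext y
        simp only [Set.mem_preimage, Set.mem_ofPred_eq, Set.mem_empty_iff_false, iff_false]
        rintro ⟨h0, h1, h2⟩; exact hx ⟨h0, by linarith⟩
      rw [this, measure_empty]
  simp only [hs]
  rw [lintegral_indicator measurableSet_Icc, ← ofReal_integral_eq_lintegral_ofReal,
    integral_Icc_eq_integral_Ioo, integral_Ioo_one_sub]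
  · exact ContinuousOn.integrableOn_Icc (by fun_prop)
  · filter_upwards [ae_restrict_mem measurableSet_Icc] with x hx
    simpa using hx.2

/-- The linear map sending the standard basis to `a`, `b`. -/
noncomputable def frameMap (a b : Plane) : Plane →ₗ[ℝ] Plane :=
  Matrix.toLin (EuclideanSpace.basisFun (Fin 2) ℝ).toBasis (EuclideanSpace.basisFun (Fin 2) ℝ).toBasis
    !![a 0, b 0; a 1, b 1]

lemma frameMap_apply (a b x : Plane) : frameMap a b x = x 0 • a + x 1 • b := by
  rw [frameMap, Matrix.toLin_apply]
  ext i
  fin_cases i <;> simp [Matrix.mulVec, dotProduct, Fin.sum_univ_two] <;> ring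

lemma det_frameMap (a b : Plane) : LinearMap.det (frameMap a b) = planeDet a b := by
  rw [frameMap, LinearMap.det_toLin, Matrix.det_fin_two_of, planeDet]; ring

lemma volume_frameMap_open {a b : Plane} (h : 0 < planeDet a b) :
    volume (frameMap a b '' openTriangle) = ENNReal.ofReal (planeDet a b / 2) := by
  rw [Measure.addHaar_image_linearMap, det_frameMap, abs_of_pos h, volume_openTriangle,
    ← ENNReal.ofReal_mul h.le]
  congr 1; ring

lemma volume_frameMap_closed {a b : Plane} (h : 0 < planeDet a b) :
    volume (frameMap a b '' closedTriangle) = ENNReal.ofReal (planeDet a b / 2) := by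
  rw [Measure.addHaar_image_linearMap, det_frameMap, abs_of_pos h, volume_closedTriangle,
    ← ENNReal.ofReal_mul h.le]
  congr 1; ring

lemma mem_frameMap_closed {a b : Plane} (h : 0 < planeDet a b) {x : Plane}
    (h1 : 0 ≤ planeDet a x) (h2 : 0 ≤ planeDet x b)
    (h3 : planeDet a x + planeDet x b ≤ planeDet a b) :
    x ∈ frameMap a b '' closedTriangle := by
  refine ⟨!₂[planeDet x b / planeDet a b, planeDet a x / planeDet a b], ⟨?_, ?_, ?_⟩, ?_⟩
  · simpa using by positivity
  · simpa using by positivity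
  · simp only [Matrix.cons_val_zero, Matrix.cons_val_one]
    rw [← add_div, div_le_one h, add_comm]; exact h3
  · rw [frameMap_apply]
    simpa using (eq_combination h.ne' x).symm

lemma planeDet_pos_of_mem_open {a b : Plane} (h : 0 < planeDet a b) {x : Plane}
    (hx : x ∈ frameMap a b '' openTriangle) : 0 < planeDet a x ∧ 0 < planeDet x b := by
  obtain ⟨y, ⟨h0, h1, _⟩, rfl⟩ := hx
  rw [frameMap_apply, planeDet_add_right, planeDet_add_left, planeDet_smul_right,
    planeDet_smul_right, planeDet_smul_left, planeDet_smul_left, planeDet_self, planeDet_self]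
  constructor <;> simp <;> positivity

lemma measurableSet_frameMap_open {a b : Plane} (h : 0 < planeDet a b) :
    MeasurableSet (frameMap a b '' openTriangle) := by
  have : IsUnit (LinearMap.det (frameMap a b)) := by
    rw [det_frameMap]; exact h.ne'.isUnit
  have ho : IsOpen openTriangle := by
    refine IsOpen.and ?_ (IsOpen.and ?_ ?_)
    · exact isOpen_lt (by fun_prop) (by fun_prop)
    · exact isOpen_lt (by fun_prop) (by fun_prop)
    · exact isOpen_lt (by fun_prop) (by fun_prop)
  have hi := (LinearMap.equivOfDetNeZero (frameMap a b)
    (by rw [det_frameMap]; exact h.ne')).toContinuousLinearEquiv.toHomeomorph.isOpenMap _ ho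
  exact hi.measurableSet

lemma sum_two_mul_range {m : ℕ} {f : ℕ → ℝ} (hf : ∀ i, f (i + m) = f i) :
    ∑ i ∈ range (2 * m), f i = 2 * ∑ i ∈ range m, f i := by
  rw [two_mul m, Finset.sum_range_add, two_mul]
  congr 1
  exact Finset.sum_congr rfl fun i _ => by rw [add_comm, hf]

lemma exists_sign_change {f : ℕ → ℝ} {m : ℕ} (h0 : 0 ≤ f 0) (hm : f m ≤ 0) (hpos : 0 < m) :
    ∃ i < m, 0 ≤ f i ∧ f (i + 1) ≤ 0 := by
  by_contra! h
  have : ∀ i ≤ m, 0 ≤ f i ∧ (0 < i → 0 < f i) := by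
    intro i
    induction i with
    | zero => exact fun _ => ⟨h0, fun h => absurd h (lt_irrefl 0)⟩
    | succ k ih =>
      intro hk
      have := h k (by omega) (ih (by omega)).1
      exact ⟨this.le, fun _ => this⟩
  exact absurd ((this m le_rfl).2 hpos) (not_lt.2 hm)

section Antiperiodic

variable {m : ℕ} {v : ℕ → Plane}

/-- Consecutive cones of an antiperiodic sequence cover the plane. -/
lemma exists_cone (hm : 0 < m) (hanti : ∀ i, v (i + m) = -v i) (x : Plane) :
    ∃ i < 2 * m, 0 ≤ planeDet (v i) x ∧ 0 ≤ planeDet x (v (i + 1)) := by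
  have hσ : ∀ i, planeDet (v (i + m)) x = -planeDet (v i) x := fun i => by
    rw [hanti, planeDet_neg_left]
  -- The sign of det(v_i, x) reverses over half a turn; start at 0 or at `m` so that it goes from
  -- nonnegative to nonpositive.
  rcases le_total 0 (planeDet (v 0) x) with h | h
  · have h' := hσ 0
    rw [zero_add] at h'
    obtain ⟨i, hi, h1, h2⟩ := exists_sign_change (f := fun i => planeDet (v i) x) h
      (by simp only [h']; linarith) hm
    exact ⟨i, by omega, h1, by rw [planeDet_swap]; linarith⟩
  · have h' := hσ 0
    obtain ⟨i, hi, h1, h2⟩ := exists_sign_change (f := fun i => planeDet (v (i + m)) x) (m := m)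
      (by simp only [h']; linarith)
      (by rw [zero_add] at h'; simp only [hσ, h']; linarith) hm
    exact ⟨i + m, by omega, h1, by rw [planeDet_swap, show i + m + 1 = i + 1 + m by omega]; linarith⟩

/-- The cones cover the plane, and the hypothesis puts the part of `S` in each cone inside a closed
triangle. Overlaps do not matter for an upper bound, so the sequence may wind more than once. -/
lemma volume_le_sum (hm : 0 < m) (hanti : ∀ i, v (i + m) = -v i)
    (hpos : ∀ i, 0 < planeDet (v i) (v (i + 1))) {S : Set Plane}
    (hS : ∀ x ∈ S, ∀ i, 0 ≤ planeDet (v i) x → 0 ≤ planeDet x (v (i + 1)) →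
      planeDet (v i) x + planeDet x (v (i + 1)) ≤ planeDet (v i) (v (i + 1))) :
    volume S ≤ ENNReal.ofReal (∑ i ∈ range m, planeDet (v i) (v (i + 1))) := by
  have hsub : S ⊆ ⋃ i ∈ range (2 * m), frameMap (v i) (v (i + 1)) '' closedTriangle := by
    intro x hx
    obtain ⟨i, hi, h1, h2⟩ := exists_cone hm hanti x
    exact Set.mem_biUnion (Finset.mem_coe.2 (Finset.mem_range.2 hi))
      (mem_frameMap_closed (hpos i) h1 h2 (hS x hx i h1 h2))
  refine (measure_mono hsub).trans ((measure_biUnion_finset_le _ _).trans ?_)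
  simp only [fun i => volume_frameMap_closed (hpos i)]
  rw [← ENNReal.ofReal_sum_of_nonneg fun i _ => by have := hpos i; positivity]
  rw [sum_two_mul_range (f := fun i => planeDet (v i) (v (i + 1)) / 2), ← Finset.sum_div]
  · apply ENNReal.ofReal_le_ofReal; linarith
  · intro i
    rw [show i + m + 1 = i + 1 + m by omega, hanti, hanti]; simp

end Antiperiodic

namespace IsSymmetricCycle

variable {m : ℕ} {v : ℕ → Plane}

/-- Once the sequence has passed the direction of `x`, it stays beyond it for half a turn, by the
Plücker relation. This makes the open triangles of `sum_le_volume` disjoint. -/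
lemma planeDet_neg_of_crossing (hv : IsSymmetricCycle m v) {x : Plane} {i : ℕ}
    (h1 : 0 < planeDet (v i) x) (h2 : planeDet (v (i + 1)) x < 0) {k : ℕ} (hk : i < k)
    (hkm : k ≤ i + m) : planeDet (v k) x < 0 := by
  rcases hkm.eq_or_lt with rfl | hlt
  · rw [hv.anti, planeDet_neg_left]; linarith
  rcases (show i + 1 ≤ k from hk).eq_or_lt with rfl | hgt
  · exact h2
  have hp := planeDet_plucker (v i) (v (i + 1)) (v k) x
  have a := hv.planeDet_succ_pos i
  have b := hv.planeDet_pos i k hk hlt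
  have c := hv.planeDet_pos (i + 1) k hgt (by omega)
  nlinarith [mul_pos h1 c, mul_neg_of_pos_of_neg b h2]

lemma sum_le_volume (hv : IsSymmetricCycle m v) {S : Set Plane} (hS : Convex ℝ S)
    (h0 : (0 : Plane) ∈ S) (hvS : ∀ i, v i ∈ S) :
    ENNReal.ofReal (∑ i ∈ range m, planeDet (v i) (v (i + 1))) ≤ volume S := by
  have hpos := hv.planeDet_succ_pos
  have hsub : (⋃ i ∈ range (2 * m), frameMap (v i) (v (i + 1)) '' openTriangle) ⊆ S := by
    intro x hx
    simp only [Set.mem_iUnion] at hx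
    obtain ⟨i, _, y, ⟨hy0, hy1, hy2⟩, rfl⟩ := hx
    rw [frameMap_apply]
    have := hS.sum_mem (t := (univ : Finset (Fin 3))) (w := ![y 0, y 1, 1 - y 0 - y 1])
      (z := ![v i, v (i + 1), 0])
      (by intro j _; fin_cases j <;> simp <;> linarith)
      (by simp [Fin.sum_univ_three])
      (by intro j _; fin_cases j <;> simp [h0, hvS])
    simpa [Fin.sum_univ_three] using this
  refine le_trans ?_ (measure_mono hsub)
  rw [measure_biUnion_finset]
  · simp only [fun i => volume_frameMap_open (hpos i)]
    rw [← ENNReal.ofReal_sum_of_nonneg fun i _ => by have := hpos i; positivity]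
    rw [sum_two_mul_range (f := fun i => planeDet (v i) (v (i + 1)) / 2), ← Finset.sum_div]
    · apply ENNReal.ofReal_le_ofReal; linarith
    · intro i
      rw [hv.planeDet_succ_add]
  · have key : ∀ i j, i < j → j < 2 * m → Disjoint (frameMap (v i) (v (i + 1)) '' openTriangle)
        (frameMap (v j) (v (j + 1)) '' openTriangle) := by
      intro i j hij hj
      rw [Set.disjoint_left]
      intro x hx hx'
      obtain ⟨a1, a2⟩ := planeDet_pos_of_mem_open (hpos i) hx
      obtain ⟨b1, b2⟩ := planeDet_pos_of_mem_open (hpos j) hx'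
      rw [planeDet_swap] at a2 b2
      have hneg := fun k => hv.planeDet_neg_of_crossing (k := k) a1 (by linarith)
      rcases le_or_gt j (i + m) with hjm | hjm
      · have := hneg j hij hjm; linarith
      -- In the opposite half-turn the contradiction comes from the far side of cone `j`, hence from
      -- the index `k + 1`.
      · obtain ⟨k, rfl⟩ : ∃ k, j = k + m := ⟨j - m, by omega⟩
        have := hneg (k + 1) (by omega) (by omega)
        rw [show k + m + 1 = k + 1 + m by omega, hv.anti, planeDet_neg_left] at b2
        linarith
    intro i hi j hj hij
    have hi := Finset.mem_range.1 (Finset.mem_coe.1 hi)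
    have hj := Finset.mem_range.1 (Finset.mem_coe.1 hj)
    rcases lt_or_gt_of_ne hij with h | h
    · exact key i j h hj
    · exact (key j i h hi).symm
  · exact fun i _ => measurableSet_frameMap_open (hpos i)

end IsSymmetricCycle

/-! ### Ordering the extreme points into a cycle -/

lemma self_eq_neg_plane {x : Plane} : x = -x ↔ x = 0 := by
  refine ⟨fun h => ?_, fun h => by simp [h]⟩
  ext i
  have : x i = -x i := congrArg (fun y : Plane => y i) h
  simpa using (by linarith : x i = 0)

/-- An antiperiodic extension of half a turn of vertices. -/
lemma exists_cycle_extending {m : ℕ} (hm : 2 ≤ m) (u : ℕ → Plane)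
    (hu : ∀ i j, i < j → j < m → 0 < planeDet (u i) (u j)) :
    ∃ v, IsSymmetricCycle m v ∧ ∀ i < m, v i = u i := by
  set v : ℕ → Plane := fun k => (-1 : ℝ) ^ (k / m) • u (k % m) with hv
  have hvu : ∀ i < m, v i = u i := fun i hi => by
    simp [hv, Nat.div_eq_of_lt hi, Nat.mod_eq_of_lt hi]
  have hanti : ∀ i, v (i + m) = -v i := fun i => by
    simp [hv, Nat.add_div_right i (show 0 < m by omega), pow_succ]
  refine ⟨v, ⟨hm, hanti, ?_⟩, hvu⟩
  intro i
  induction i using Nat.strong_induction_on with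
  | _ i ih =>
    intro j hij hjm
    by_cases hi : i < m
    · by_cases hj : j < m
      · rw [hvu i hi, hvu j hj]; exact hu i j hij hj
      · obtain ⟨k, rfl⟩ : ∃ k, j = k + m := ⟨j - m, by omega⟩
        rw [hanti, hvu i hi, hvu k (by omega), planeDet_neg_right, ← planeDet_swap]
        exact hu k i (by omega) hi
    · obtain ⟨k, rfl⟩ : ∃ k, i = k + m := ⟨i - m, by omega⟩
      obtain ⟨l, rfl⟩ : ∃ l, j = l + m := ⟨j - m, by omega⟩
      rw [hanti, hanti, planeDet_neg_left, planeDet_neg_right, neg_neg]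
      exact ih k (by omega) l (by omega) (by omega)

namespace IsSymmetricCycle

variable {m : ℕ} {v : ℕ → Plane}

lemma add_two_mul (hv : IsSymmetricCycle m v) (i k : ℕ) : v (i + 2 * m * k) = v i := by
  induction k with
  | zero => simp
  | succ k ih =>
    rw [show i + 2 * m * (k + 1) = i + 2 * m * k + m + m by ring, hv.anti, hv.anti, neg_neg, ih]

/-- Each vertex has an index in any given full turn. -/
lemma exists_index (hv : IsSymmetricCycle m v) (i j : ℕ) :
    ∃ k, i ≤ k ∧ k < i + 2 * m ∧ v k = v j := by
  have hm := hv.two_le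
  have hpos : 0 < 2 * m := by omega
  -- Adding `2 * m * i`, a multiple of the period, keeps the natural subtraction from truncating.
  refine ⟨i + (j + 2 * m * i - i) % (2 * m), by omega, ?_, ?_⟩
  · have := Nat.mod_lt (j + 2 * m * i - i) hpos; omega
  · have h1 : i ≤ 2 * m * i := by nlinarith
    have h2 := Nat.mod_add_div (j + 2 * m * i - i) (2 * m)
    rw [← hv.add_two_mul _ ((j + 2 * m * i - i) / (2 * m)), ← hv.add_two_mul j i]
    congr 1; omega

lemma injOn (hv : IsSymmetricCycle m v) : Set.InjOn v (Set.Iio (2 * m)) := by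
  have key : ∀ i j, i < j → j < 2 * m → v i ≠ v j := by
    intro i j hij hj h
    rcases lt_trichotomy j (i + m) with hlt | rfl | hgt
    · have := hv.planeDet_pos i j hij hlt
      rw [h, planeDet_self] at this
      exact lt_irrefl _ this
    · rw [hv.anti, self_eq_neg_plane] at h
      have := hv.planeDet_succ_pos i
      rw [h] at this
      simp [planeDet] at this
    · obtain ⟨k, rfl⟩ : ∃ k, j = k + m := ⟨j - m, by omega⟩
      have := hv.planeDet_pos i k (by omega) (by omega)
      rw [h, hv.anti, planeDet_neg_left, planeDet_self, neg_zero] at this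
      exact lt_irrefl _ this
  intro i hi j hj h
  rcases lt_trichotomy i j with hlt | rfl | hgt
  · exact absurd h (key i j hlt hj)
  · rfl
  · exact absurd h.symm (key j i hgt hi)

/-- Converts the bound on the number of vertices into `m ≤ N`. -/
lemma two_mul_le_encard_range (hv : IsSymmetricCycle m v) :
    ((2 * m : ℕ) : ℕ∞) ≤ (Set.range v).encard := by
  have h : (v '' Set.Iio (2 * m)).encard = (2 * m : ℕ) := by
    rw [hv.injOn.encard_image, ← Finset.coe_Iio, Set.encard_coe_eq_coe_finsetCard, Nat.card_Iio]
  rw [← h]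
  exact Set.encard_le_encard (Set.image_subset_range _ _)

end IsSymmetricCycle

section ExtremePoints

variable {K : Set Plane}

lemma exists_planeDet_ne_zero (hint : (interior K).Nonempty) {a : Plane} (ha : a ≠ 0) :
    ∃ p ∈ K, planeDet a p ≠ 0 := by
  by_contra! h
  obtain ⟨y, hy⟩ := hint
  have hc : Filter.Tendsto (fun t : ℝ => y + t • !₂[-a 1, a 0]) (nhds 0) (nhds y) := by
    have : Continuous (fun t : ℝ => y + t • !₂[-a 1, a 0]) := by fun_prop
    simpa using this.tendsto 0
  have hev := hc.eventually (isOpen_interior.mem_nhds hy)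
  obtain ⟨ε, hε, hb⟩ := Metric.eventually_nhds_iff.1 hev
  have hm : y + (ε / 2) • !₂[-a 1, a 0] ∈ interior K :=
    hb (by simp [abs_of_pos hε]; linarith)
  have h1 := h _ (interior_subset hm)
  rw [planeDet_add_right, h _ (interior_subset hy), planeDet_smul_right] at h1
  have h2 : planeDet a !₂[-a 1, a 0] = a 0 ^ 2 + a 1 ^ 2 := by simp [planeDet]; ring
  rw [h2, zero_add] at h1
  have h3 : a 0 ^ 2 + a 1 ^ 2 = 0 := (mul_eq_zero.1 h1).resolve_left (by positivity)
  apply ha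
  ext i
  fin_cases i
  · simpa using (by nlinarith [sq_nonneg (a 0), sq_nonneg (a 1)] : a 0 ^ 2 = 0)
  · simpa using (by nlinarith [sq_nonneg (a 0), sq_nonneg (a 1)] : a 1 ^ 2 = 0)

lemma zero_notMem_extremePoints (hsymm : IsOriginSymmetric K) (hint : (interior K).Nonempty) :
    (0 : Plane) ∉ Set.extremePoints ℝ K := by
  intro h
  have hne : (!₂[1, 0] : Plane) ≠ 0 := fun h => by simpa using congrArg (· 0) h
  obtain ⟨p, hp, hpne⟩ := exists_planeDet_ne_zero hint hne
  have h0 : (0 : Plane) ∈ openSegment ℝ p (-p) :=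
    ⟨1 / 2, 1 / 2, by norm_num, by norm_num, by norm_num, by simp⟩
  have := (mem_extremePoints.1 h).2 p hp (-p) (hsymm p hp) h0
  rw [this.1] at hpne
  simp [planeDet] at hpne

lemma zero_mem_of_symmetric (hconv : Convex ℝ K) (hsymm : IsOriginSymmetric K)
    (hint : (interior K).Nonempty) : (0 : Plane) ∈ K := by
  obtain ⟨y, hy⟩ := hint.mono interior_subset
  have := hconv hy (hsymm y hy) (a := 1 / 2) (b := 1 / 2) (by norm_num) (by norm_num) (by norm_num)
  simpa using this

/-- Such a `z` lies strictly between the origin and the point of `K` obtained by normalising the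
weights, which extremality of a nonzero `z` excludes. -/
lemma extreme_combination_false (hconv : Convex ℝ K) (hsymm : IsOriginSymmetric K)
    (hint : (interior K).Nonempty) {x y z : Plane} (hx : x ∈ K) (hy : y ∈ K)
    (hz : z ∈ Set.extremePoints ℝ K) {a b c : ℝ} (ha : 0 ≤ a) (hb : 0 ≤ b) (hc : a + b < c)
    (h : c • z = a • x + b • y) : False := by
  have hz0 : z ≠ 0 := fun h => zero_notMem_extremePoints hsymm hint (h ▸ hz)
  have hc0 : 0 < c := by linarith
  have hab : 0 < a + b := by
    rcases (add_nonneg ha hb).eq_or_lt with h0 | h0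
    · have ha0 : a = 0 := by linarith
      have hb0 : b = 0 := by linarith
      rw [ha0, hb0, zero_smul, zero_smul, zero_add, smul_eq_zero] at h
      exact absurd h (not_or.2 ⟨hc0.ne', hz0⟩)
    · exact h0
  have hp : (a / (a + b)) • x + (b / (a + b)) • y ∈ K :=
    hconv hx hy (by positivity) (by positivity) (by field_simp)
  have hzc : z = c⁻¹ • (a • x + b • y) := by
    rw [← h, smul_smul, inv_mul_cancel₀ hc0.ne', one_smul]
  have hmem : z ∈ openSegment ℝ (0 : Plane) ((a / (a + b)) • x + (b / (a + b)) • y) := by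
    refine ⟨1 - (a + b) / c, (a + b) / c, ?_, by positivity, by ring, ?_⟩
    · rw [sub_pos, div_lt_one hc0]; exact hc
    · rw [smul_zero, zero_add, hzc, smul_add, smul_add, smul_smul, smul_smul, smul_smul, smul_smul]
      congr 2 <;> field_simp
  have := (mem_extremePoints.1 hz).2 0 (zero_mem_of_symmetric hconv hsymm hint) _ hp hmem
  exact hz0 this.1.symm

lemma neg_mem_extremePoints (hsymm : IsOriginSymmetric K) {z : Plane}
    (hz : z ∈ Set.extremePoints ℝ K) : -z ∈ Set.extremePoints ℝ K := by
  rw [mem_extremePoints] at hz ⊢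
  refine ⟨hsymm _ hz.1, fun x hx y hy h => ?_⟩
  have : z ∈ openSegment ℝ (-x) (-y) := by
    obtain ⟨a, b, ha, hb, hab, h⟩ := h
    exact ⟨a, b, ha, hb, hab, by rw [smul_neg, smul_neg, ← neg_add, h, neg_neg]⟩
  obtain ⟨h1, h2⟩ := hz.2 _ (hsymm x hx) _ (hsymm y hy) this
  exact ⟨by rw [← h1, neg_neg], by rw [← h2, neg_neg]⟩

lemma extreme_smul_false (hconv : Convex ℝ K) (hsymm : IsOriginSymmetric K)
    (hint : (interior K).Nonempty) {x z : Plane} (hx : x ∈ K)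
    (hz : z ∈ Set.extremePoints ℝ K) {a c : ℝ} (hac : |a| < c) (h : c • z = a • x) : False := by
  rcases le_total 0 a with ha | ha
  · rw [abs_of_nonneg ha] at hac
    exact extreme_combination_false hconv hsymm hint hx hx hz ha le_rfl (by simpa using hac)
      (by simpa using h)
  · rw [abs_of_nonpos ha] at hac
    exact extreme_combination_false hconv hsymm hint (hsymm x hx) hx hz (neg_nonneg.2 ha) le_rfl
      (by simpa using hac) (by simpa using h)

lemma eq_or_neg_of_planeDet_eq_zero (hconv : Convex ℝ K) (hsymm : IsOriginSymmetric K)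
    (hint : (interior K).Nonempty) {a b : Plane} (ha : a ∈ Set.extremePoints ℝ K)
    (hb : b ∈ Set.extremePoints ℝ K) (h : planeDet a b = 0) : b = a ∨ b = -a := by
  have ha0 : a ≠ 0 := fun h => zero_notMem_extremePoints hsymm hint (h ▸ ha)
  obtain ⟨t, rfl⟩ : ∃ t : ℝ, b = t • a := by
    by_cases h0 : a 0 = 0
    · have h1 : a 1 ≠ 0 := by
        intro h1; apply ha0; ext i; fin_cases i <;> simp [h0, h1]
      refine ⟨b 1 / a 1, ?_⟩
      have hb0 : b 0 = 0 := by simpa [planeDet, h0, h1] using h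
      ext i; fin_cases i
      · simp [h0, hb0]
      · simp [h1]
    · refine ⟨b 0 / a 0, ?_⟩
      ext i; fin_cases i
      · simp [h0]
      · simp only [planeDet] at h
        simp only [Fin.mk_one, PiLp.smul_apply, smul_eq_mul]
        field_simp; linarith
  rcases lt_trichotomy |t| 1 with hlt | heq | hgt
  · exact (extreme_smul_false hconv hsymm hint ha.1 hb hlt (one_smul _ _)).elim
  · rcases (abs_eq zero_le_one).1 heq with rfl | rfl
    · left; simp
    · right; simp
  · rcases le_total 0 t with ht | ht
    · rw [abs_of_nonneg ht] at hgt
      exact (extreme_smul_false hconv hsymm hint hb.1 ha (a := 1) (by simpa using hgt)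
        (one_smul _ _).symm).elim
    · rw [abs_of_nonpos ht] at hgt
      exact (extreme_smul_false hconv hsymm hint hb.1 ha (a := -1) (c := -t) (by simpa using hgt)
        (by simp)).elim

/-- The extreme points of an origin symmetric polygon form a symmetric cycle. -/
theorem exists_cycle_range_eq (hconv : Convex ℝ K) (hsymm : IsOriginSymmetric K)
    (hint : (interior K).Nonempty) (hfin : (Set.extremePoints ℝ K).Finite)
    (hull : K = convexHull ℝ (Set.extremePoints ℝ K)) :
    ∃ m v, IsSymmetricCycle m v ∧ Set.range v = Set.extremePoints ℝ K := by
  classical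
  have hKne : K.Nonempty := hint.mono interior_subset
  obtain ⟨a, ha⟩ : (Set.extremePoints ℝ K).Nonempty := by
    rw [hull] at hKne; exact convexHull_nonempty_iff.1 hKne
  have ha0 : a ≠ 0 := fun h => zero_notMem_extremePoints hsymm hint (h ▸ ha)
  -- The extreme points strictly to the left of the line through `a`; together with `a` they form
  -- half a turn.
  set H : Finset Plane := hfin.toFinset.filter (fun x => 0 < planeDet a x) with hH
  have memH : ∀ x, x ∈ H ↔ x ∈ Set.extremePoints ℝ K ∧ 0 < planeDet a x := fun x => by
    simp [hH]
  have hHne : H.Nonempty := by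
    by_contra hemp
    rw [Finset.not_nonempty_iff_eq_empty] at hemp
    obtain ⟨p, hp, hpne⟩ := exists_planeDet_ne_zero hint ha0
    have hz : ∀ x ∈ Set.extremePoints ℝ K, planeDet a x = 0 := by
      intro x hx
      have h1 : ¬ 0 < planeDet a x := fun h => by
        have := (memH x).2 ⟨hx, h⟩
        rw [hemp] at this; simp at this
      have h2 : ¬ 0 < planeDet a (-x) := fun h => by
        have := (memH (-x)).2 ⟨neg_mem_extremePoints hsymm hx, h⟩
        rw [hemp] at this; simp at this
      rw [planeDet_neg_right] at h2
      linarith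
    have hsub : convexHull ℝ (Set.extremePoints ℝ K) ⊆ {x | planeDet a x = 0} := by
      refine convexHull_min hz ?_
      intro x hx y hy s t _ _ _
      simp only [Set.mem_ofPred_eq] at hx hy ⊢
      rw [planeDet_add_right, planeDet_smul_right, planeDet_smul_right, hx, hy]; ring
    rw [← hull] at hsub
    exact hpne (hsub hp)
  -- Minus the cotangent of the angle from `a` to `x`, which increases with the angle on (0, π).
  set key : Plane → ℝ := fun x => -(a 0 * x 0 + a 1 * x 1) / planeDet a x with hkey
  have ha2 : 0 < a 0 ^ 2 + a 1 ^ 2 := by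
    rcases (add_nonneg (sq_nonneg (a 0)) (sq_nonneg (a 1))).eq_or_lt with h | h
    · exfalso; apply ha0; ext i; fin_cases i
      · simpa using (by nlinarith [sq_nonneg (a 0), sq_nonneg (a 1)] : a 0 ^ 2 = 0)
      · simpa using (by nlinarith [sq_nonneg (a 0), sq_nonneg (a 1)] : a 1 ^ 2 = 0)
    · exact h
  have key_sub : ∀ x ∈ H, ∀ y ∈ H,
      key y - key x = (a 0 ^ 2 + a 1 ^ 2) * planeDet x y / (planeDet a x * planeDet a y) := by
    intro x hx y hy
    have h1 := ((memH x).1 hx).2.ne'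
    have h2 := ((memH y).1 hy).2.ne'
    simp only [hkey]
    rw [eq_div_iff (mul_ne_zero h1 h2), sub_mul]
    field_simp
    simp only [planeDet]; ring
  have key_inj : Set.InjOn key H := by
    intro x hx y hy hxy
    have hx' := (memH x).1 hx
    have hy' := (memH y).1 hy
    have h := key_sub x hx y hy
    rw [hxy, sub_self, eq_comm, div_eq_zero_iff] at h
    have h0 : planeDet x y = 0 :=
      (mul_eq_zero.1 (h.resolve_right (mul_ne_zero hx'.2.ne' hy'.2.ne'))).resolve_left ha2.ne'
    rcases eq_or_neg_of_planeDet_eq_zero hconv hsymm hint hx'.1 hy'.1 h0 with h | h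
    · exact h.symm
    · have := hy'.2
      rw [h, planeDet_neg_right] at this
      linarith [hx'.2]
  have key_lt : ∀ x ∈ H, ∀ y ∈ H, key x < key y → 0 < planeDet x y := by
    intro x hx y hy hxy
    have h := key_sub x hx y hy
    have h1 := ((memH x).1 hx).2
    have h2 := ((memH y).1 hy).2
    by_contra hle
    have : (a 0 ^ 2 + a 1 ^ 2) * planeDet x y / (planeDet a x * planeDet a y) ≤ 0 :=
      div_nonpos_of_nonpos_of_nonneg (mul_nonpos_of_nonneg_of_nonpos ha2.le (not_lt.1 hle))
        (mul_pos h1 h2).le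
    linarith
  have hcard : (H.image key).card = H.card := Finset.card_image_of_injOn key_inj
  set e := (H.image key).orderEmbOfFin hcard with he
  have hex : ∀ i : Fin H.card, ∃ x ∈ H, key x = e i := fun i =>
    Finset.mem_image.1 (Finset.orderEmbOfFin_mem _ hcard i)
  choose b hbH hbe using hex
  have hsurj : ∀ x ∈ H, ∃ i, b i = x := by
    intro x hx
    have : key x ∈ Set.range e := by
      rw [he, Finset.range_orderEmbOfFin]
      exact Finset.mem_coe.2 (Finset.mem_image_of_mem _ hx)
    obtain ⟨i, hi⟩ := this
    exact ⟨i, key_inj (hbH i) hx (by rw [hbe, hi])⟩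
  set u : ℕ → Plane := fun k => if h : k - 1 < H.card ∧ 0 < k then b ⟨k - 1, h.1⟩ else a with hu
  have hu0 : u 0 = a := by simp [hu]
  have hus : ∀ i : Fin H.card, u (i + 1) = b i := fun i => by simp [hu]
  have hHc : 0 < H.card := Finset.card_pos.2 hHne
  obtain ⟨v, hv, hvu⟩ := exists_cycle_extending (m := H.card + 1) (by omega) u (by
    intro i j hij hj
    obtain ⟨l, rfl⟩ : ∃ l, j = l + 1 := ⟨j - 1, by omega⟩
    have hul := hus ⟨l, by omega⟩
    simp only at hul
    rw [hul]
    rcases Nat.eq_zero_or_pos i with rfl | hi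
    · rw [hu0]; exact ((memH _).1 (hbH _)).2
    · obtain ⟨k, rfl⟩ : ∃ k, i = k + 1 := ⟨i - 1, by omega⟩
      have huk := hus ⟨k, by omega⟩
      simp only at huk
      rw [huk]
      refine key_lt _ (hbH _) _ (hbH _) ?_
      rw [hbe, hbe]
      exact e.strictMono (by simpa using hij))
  refine ⟨H.card + 1, v, hv, Set.Subset.antisymm ?_ ?_⟩
  · rintro _ ⟨i, rfl⟩
    induction i using Nat.strong_induction_on with
    | _ i ih =>
      by_cases hi : i < H.card + 1
      · rw [hvu i hi]
        simp only [hu]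
        split_ifs with h
        · exact ((memH _).1 (hbH _)).1
        · exact ha
      · obtain ⟨k, rfl⟩ : ∃ k, i = k + (H.card + 1) := ⟨i - (H.card + 1), by omega⟩
        rw [hv.anti]
        exact neg_mem_extremePoints hsymm (ih k (by omega))
  · have hHr : ∀ x ∈ H, ∃ k, v k = x := by
      intro x hx
      obtain ⟨i, rfl⟩ := hsurj x hx
      exact ⟨i + 1, by rw [hvu _ (by omega), hus]⟩
    have hv0 : v 0 = a := by rw [hvu 0 (by omega), hu0]
    intro x hx
    rcases lt_trichotomy (planeDet a x) 0 with h | h | h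
    · obtain ⟨k, hk⟩ := hHr (-x) ((memH _).2 ⟨neg_mem_extremePoints hsymm hx, by
        rw [planeDet_neg_right]; linarith⟩)
      exact ⟨k + (H.card + 1), by rw [hv.anti, hk, neg_neg]⟩
    · rcases eq_or_neg_of_planeDet_eq_zero hconv hsymm hint ha hx h with rfl | rfl
      · exact ⟨0, hv0⟩
      · exact ⟨0 + (H.card + 1), by rw [hv.anti, hv0]⟩
    · exact hHr x ((memH _).2 ⟨hx, h⟩)

end ExtremePoints

/-- Krein–Milman; no closure is needed, since the hull of finitely many points is closed. -/
lemma convexPolygon_eq_hull {K : Set Plane} (hK : IsConvexPolygon K) :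
    (Set.extremePoints ℝ K).Finite ∧ K = convexHull ℝ (Set.extremePoints ℝ K) := by
  obtain ⟨⟨S, hS, rfl⟩, _⟩ := hK
  have hfin : (Set.extremePoints ℝ (convexHull ℝ S)).Finite :=
    hS.subset extremePoints_convexHull_subset
  refine ⟨hfin, ?_⟩
  have h := closure_convexHull_extremePoints (s := convexHull ℝ S)
    (hS.isCompact_convexHull ℝ) (convex_convexHull ℝ S)
  rw [(hfin.isClosed_convexHull ℝ).closure_eq] at h
  exact h.symm

/-! ### Upper area bounds for the polygon and its polar -/

namespace IsSymmetricCycle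

variable {m : ℕ} {v : ℕ → Plane} {K : Set Plane}

/-- No vertex lies beyond the line through v_i and v_{i+1}: otherwise the relation among the three
vectors would put an endpoint of the edge strictly inside `K`. The endpoint is v_{i+1} when v_k is
in the half-turn after the edge, and v_i when it is in the other. -/
lemma cone_sum_le (hv : IsSymmetricCycle m v) (hr : Set.range v = Set.extremePoints ℝ K)
    (hconv : Convex ℝ K) (hsymm : IsOriginSymmetric K) (hint : (interior K).Nonempty) (i j : ℕ) :
    planeDet (v i) (v j) + planeDet (v j) (v (i + 1)) ≤ planeDet (v i) (v (i + 1)) := by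
  have hD := hv.planeDet_succ_pos i
  have hext : ∀ k, v k ∈ Set.extremePoints ℝ K := fun k => hr ▸ Set.mem_range_self k
  obtain ⟨k, hik, hk, hkj⟩ := hv.exists_index i j
  rw [← hkj]
  by_contra! hgt
  have hcomb := planeDet_smul_eq (v i) (v (i + 1)) (v k)
  rcases hik.eq_or_lt with rfl | hik
  · simp at hgt
  rcases (show i + 1 ≤ k from hik).eq_or_lt with rfl | hik'
  · simp at hgt
  rcases le_or_gt k (i + m) with hkm | hkm
  · have h1 := hv.planeDet_pos (i + 1) k hik' (by omega)
    have h2 := planeDet_swap (v k) (v (i + 1))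
    refine extreme_combination_false hconv hsymm hint (hext k).1 (hext i).1 (hext (i + 1))
      (a := planeDet (v i) (v (i + 1))) (b := planeDet (v (i + 1)) (v k))
      (c := planeDet (v i) (v k)) hD.le h1.le (by linarith) ?_
    rw [hcomb, h2, neg_smul]; abel
  · obtain ⟨l, rfl⟩ : ∃ l, k = l + m := ⟨k - m, by omega⟩
    have h1 := hv.planeDet_pos i l (by omega) (by omega)
    have h2 : planeDet (v i) (v (l + m)) = -planeDet (v i) (v l) := by
      rw [hv.anti, planeDet_neg_right]
    refine extreme_combination_false hconv hsymm hint (hext (l + m)).1 (hext (i + 1)).1 (hext i)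
      (a := planeDet (v i) (v (i + 1))) (b := planeDet (v i) (v l))
      (c := planeDet (v (l + m)) (v (i + 1))) hD.le h1.le (by linarith) ?_
    rw [hcomb, h2, neg_smul]; abel

/-- The numerator is nonnegative by `cone_sum_le` at index `i + 2`; if it were zero, v_{i+1} would
lie inside the segment from v_i to v_{i+2}. -/
lemma dual_planeDet_pos (hv : IsSymmetricCycle m v) (hr : Set.range v = Set.extremePoints ℝ K)
    (hconv : Convex ℝ K) (hsymm : IsOriginSymmetric K) (hint : (interior K).Nonempty) (i : ℕ) :
    0 < planeDet (dualCycle v i) (dualCycle v (i + 1)) := by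
  have h1 := hv.planeDet_succ_pos i
  have h2 := hv.planeDet_succ_pos (i + 1)
  rw [dualCycle, dualCycle, planeDet_dualVertex]
  refine div_pos ?_ (mul_pos h1 h2)
  have hle := hv.cone_sum_le hr hconv hsymm hint i (i + 2)
  rw [planeDet_swap (v (i + 2))] at hle
  refine lt_of_le_of_ne (by simp only [add_assoc] at *; norm_num at *; linarith) fun heq => ?_
  have hext : ∀ k, v k ∈ Set.extremePoints ℝ K := fun k => hr ▸ Set.mem_range_self k
  have hE : planeDet (v i) (v (i + 1 + 1))
      = planeDet (v i) (v (i + 1)) + planeDet (v (i + 1)) (v (i + 1 + 1)) := by linarith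
  have hcomb := planeDet_smul_eq (v i) (v (i + 1 + 1)) (v (i + 1))
  set d := planeDet (v i) (v (i + 1))
  set d' := planeDet (v (i + 1)) (v (i + 1 + 1))
  have hmem : v (i + 1) ∈ openSegment ℝ (v i) (v (i + 1 + 1)) := by
    refine ⟨d' / (d + d'), d / (d + d'), by positivity, by positivity, by field_simp; ring, ?_⟩
    rw [hE] at hcomb
    have := congrArg ((d + d')⁻¹ • ·) hcomb
    simp only [smul_add, smul_smul, inv_mul_cancel₀ (add_pos h1 h2).ne', one_smul] at this
    rw [div_eq_inv_mul, div_eq_inv_mul]; exact this.symm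
  have := ((mem_extremePoints.1 (hext (i + 1))).2 _ (hext i).1 _ (hext (i + 1 + 1)).1 hmem).1
  rw [show d = planeDet (v i) (v (i + 1)) from rfl, ← this, planeDet_self] at h1
  exact lt_irrefl _ h1

lemma volume_hull_le (hv : IsSymmetricCycle m v) (hr : Set.range v = Set.extremePoints ℝ K)
    (hconv : Convex ℝ K) (hsymm : IsOriginSymmetric K) (hint : (interior K).Nonempty)
    (hull : K = convexHull ℝ (Set.extremePoints ℝ K)) :
    volume K ≤ ENNReal.ofReal (∑ i ∈ range m, planeDet (v i) (v (i + 1))) := by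
  refine volume_le_sum (by have := hv.two_le; omega) hv.anti hv.planeDet_succ_pos ?_
  intro x hx i _ _
  have hsub : convexHull ℝ (Set.extremePoints ℝ K) ⊆
      {x | planeDet (v i) x + planeDet x (v (i + 1)) ≤ planeDet (v i) (v (i + 1))} := by
    refine convexHull_min ?_ ?_
    · rw [← hr]
      rintro _ ⟨j, rfl⟩
      exact hv.cone_sum_le hr hconv hsymm hint i j
    · intro x hx y hy s t hs ht hst
      simp only [Set.mem_ofPred_eq] at hx hy ⊢
      simp only [planeDet_add_right, planeDet_smul_right, planeDet_add_left, planeDet_smul_left]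
      calc _ = s * (planeDet (v i) x + planeDet x (v (i + 1)))
            + t * (planeDet (v i) y + planeDet y (v (i + 1))) := by ring
        _ ≤ s * planeDet (v i) (v (i + 1)) + t * planeDet (v i) (v (i + 1)) := by gcongr
        _ = _ := by rw [← add_mul, hst, one_mul]
  rw [← hull] at hsub
  exact hsub hx

/-- Biduality: the edge of the polar between two consecutive dual vertices lies on the line ⟨b, y⟩ =
1. The condition ⟨b, y⟩ ≤ 1 therefore cuts the dual cone down to its triangle. -/
lemma dual_cone_sum {a b c : Plane} (hab : planeDet a b ≠ 0) (hbc : planeDet b c ≠ 0) (y : Plane) :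
    planeDet (dualVertex a b) y + planeDet y (dualVertex b c)
      = planeDet (dualVertex a b) (dualVertex b c) * inner ℝ b y := by
  rw [planeDet_dualVertex, dualVertex, dualVertex, planeDet_smul_left, planeDet_smul_right,
    inner_plane]
  field_simp
  simp [planeDet]; ring

lemma volume_polar_le (hv : IsSymmetricCycle m v) (hr : Set.range v = Set.extremePoints ℝ K)
    (hconv : Convex ℝ K) (hsymm : IsOriginSymmetric K) (hint : (interior K).Nonempty) :
    volume (polarBody K) ≤
      ENNReal.ofReal (∑ i ∈ range m, planeDet (dualCycle v i) (dualCycle v (i + 1))) := by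
  have hpos := hv.dual_planeDet_pos hr hconv hsymm hint
  refine volume_le_sum (by have := hv.two_le; omega) hv.dual_anti hpos ?_
  intro y hy i _ _
  rw [dualCycle, dualCycle,
    dual_cone_sum (hv.planeDet_succ_pos i).ne' (hv.planeDet_succ_pos (i + 1)).ne']
  have hmem : v (i + 1) ∈ K := by
    have : v (i + 1) ∈ Set.extremePoints ℝ K := hr ▸ Set.mem_range_self _
    exact this.1
  exact mul_le_of_le_one_right (hpos i).le (hy _ hmem)

end IsSymmetricCycle

/-! ### Angles, Jensen's inequality and the sharp product bound -/

lemma sin_lt_tangent {t x : ℝ} (ht : t ∈ Set.Icc 0 Real.pi) (hx : x ∈ Set.Icc 0 Real.pi)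
    (hne : x ≠ t) : Real.sin x < Real.sin t + Real.cos t * (x - t) := by
  rcases lt_or_gt_of_ne hne with h | h
  · have := strictConcaveOn_sin_Icc.lt_slope_of_hasDerivAt hx ht h (Real.hasDerivAt_sin t)
    rw [slope_def_field, lt_div_iff₀ (by linarith)] at this
    linarith
  · have := strictConcaveOn_sin_Icc.slope_lt_of_hasDerivAt ht hx h (Real.hasDerivAt_sin t)
    rw [slope_def_field, div_lt_iff₀ (by linarith)] at this
    linarith

lemma sin_le_tangent {t x : ℝ} (ht : t ∈ Set.Icc 0 Real.pi) (hx : x ∈ Set.Icc 0 Real.pi) :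
    Real.sin x ≤ Real.sin t + Real.cos t * (x - t) := by
  rcases eq_or_ne x t with rfl | h
  · simp
  · exact (sin_lt_tangent ht hx h).le

/-- Jensen's inequality for at most `N` angles with sum `π / 2`, with the equality case. -/
lemma sum_sin_le {m N : ℕ} (hN : 2 ≤ N) (hmN : m ≤ N) {ψ : ℕ → ℝ}
    (hψ : ∀ i < m, ψ i ∈ Set.Icc 0 Real.pi) (hsum : ∑ i ∈ range m, ψ i = Real.pi / 2) :
    ∑ i ∈ range m, Real.sin (ψ i) ≤ N * Real.sin (Real.pi / (2 * N)) ∧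
    (N * Real.sin (Real.pi / (2 * N)) ≤ ∑ i ∈ range m, Real.sin (ψ i) →
      m = N ∧ ∀ i < m, ψ i = Real.pi / (2 * N)) := by
  set t := Real.pi / (2 * N) with ht
  have hNpos : (2 : ℝ) ≤ N := by exact_mod_cast hN
  have hpi := Real.pi_pos
  have htN : N * t = Real.pi / 2 := by rw [ht]; field_simp
  have ht0 : 0 < t := by positivity
  have ht2 : t < Real.pi / 2 := by
    rw [ht, div_lt_div_iff_of_pos_left hpi (by positivity) (by norm_num)]; linarith
  have htmem : t ∈ Set.Icc 0 Real.pi := ⟨ht0.le, by linarith⟩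
  -- The intercept of the tangent at `t`. Its positivity makes the bound strictly increasing in the
  -- number of angles, so fewer than `N` is strictly worse.
  have htan : 0 < Real.sin t - Real.cos t * t := by
    have := sin_lt_tangent htmem ⟨le_rfl, hpi.le⟩ ht0.ne
    rw [Real.sin_zero] at this
    linarith
  have hlin : ∑ i ∈ range m, (Real.sin t + Real.cos t * (ψ i - t))
      = m * (Real.sin t - Real.cos t * t) + Real.cos t * (Real.pi / 2) := by
    rw [← hsum, Finset.mul_sum, ← nsmul_eq_mul, ← Finset.card_range m, ← Finset.sum_const,
      Finset.card_range, ← Finset.sum_add_distrib]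
    exact Finset.sum_congr rfl fun i _ => by ring
  have hle : ∑ i ∈ range m, Real.sin (ψ i) ≤
      ∑ i ∈ range m, (Real.sin t + Real.cos t * (ψ i - t)) :=
    Finset.sum_le_sum fun i hi => sin_le_tangent htmem (hψ i (Finset.mem_range.1 hi))
  have hNt : (N : ℝ) * Real.sin t
      = N * (Real.sin t - Real.cos t * t) + Real.cos t * (Real.pi / 2) := by
    rw [← htN]; ring
  have hmN' : (m : ℝ) ≤ N := by exact_mod_cast hmN
  have hmul := mul_le_mul_of_nonneg_right hmN' htan.le
  refine ⟨by linarith, fun hge => ⟨?_, ?_⟩⟩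
  · by_contra hne
    have : (m : ℝ) < N := by exact_mod_cast lt_of_le_of_ne hmN hne
    have := mul_lt_mul_of_pos_right this htan
    linarith
  · by_contra! hex
    obtain ⟨i, hi, hne⟩ := hex
    have : ∑ i ∈ range m, Real.sin (ψ i) <
        ∑ i ∈ range m, (Real.sin t + Real.cos t * (ψ i - t)) :=
      Finset.sum_lt_sum (fun i hi => sin_le_tangent htmem (hψ i (Finset.mem_range.1 hi)))
        ⟨i, Finset.mem_range.2 hi, sin_lt_tangent htmem (hψ i hi) hne⟩
    linarith

/-- Intermediate values for `c` between 0 and the reciprocal of the largest `D i`; at the right end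
that single term already contributes π/2. -/
lemma exists_scale_arcsin {m : ℕ} (hm : 0 < m) {D : ℕ → ℝ} (hD : ∀ i, 0 < D i) :
    ∃ c : ℝ, 0 ≤ c ∧ (∀ i < m, c * D i ≤ 1) ∧
      ∑ i ∈ range m, Real.arcsin (c * D i) = Real.pi / 2 := by
  obtain ⟨k, hk, hmax⟩ := Finset.exists_max_image (range m) D ⟨0, Finset.mem_range.2 hm⟩
  have hcont : Continuous fun c : ℝ => ∑ i ∈ range m, Real.arcsin (c * D i) :=
    continuous_finsetSum _ fun i _ => Real.continuous_arcsin.comp (by fun_prop)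
  have hk0 := hD k
  have hmem : Real.pi / 2 ∈ Set.Icc (∑ i ∈ range m, Real.arcsin (0 * D i))
      (∑ i ∈ range m, Real.arcsin ((D k)⁻¹ * D i)) := by
    constructor
    · simpa using Real.pi_div_two_pos.le
    · have h := Finset.single_le_sum (f := fun i => Real.arcsin ((D k)⁻¹ * D i))
        (fun i _ => Real.arcsin_nonneg.2 (by have := hD i; positivity)) hk
      simpa [inv_mul_cancel₀ hk0.ne'] using h
  obtain ⟨c, ⟨hc0, hc1⟩, hc⟩ := intermediate_value_Icc (inv_pos.2 hk0).le hcont.continuousOn hmem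
  refine ⟨c, hc0, fun i hi => ?_, hc⟩
  have h1 := hmax i (Finset.mem_range.2 hi)
  calc c * D i ≤ (D k)⁻¹ * D k := by gcongr; exact (hD i).le
    _ = 1 := inv_mul_cancel₀ hk0.ne'

lemma chord_sq (x y : ℝ) :
    (Real.cos (x + 2 * y) - Real.cos x) ^ 2 + (Real.sin (x + 2 * y) - Real.sin x) ^ 2
      = 4 * Real.sin y ^ 2 := by
  have h1 := Real.sin_sq_add_cos_sq x
  have h2 := Real.sin_sq_add_cos_sq y
  have h3 : Real.cos (2 * y) = 1 - 2 * Real.sin y ^ 2 := by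
    rw [Real.cos_two_mul]; linarith
  rw [Real.cos_add, Real.sin_add, h3, Real.sin_two_mul]
  linear_combination (4 * Real.sin y ^ 4 + 4 * Real.sin y ^ 2 * Real.cos y ^ 2) * h1
    + 4 * Real.sin y ^ 2 * h2

namespace IsSymmetricCycle

variable {m : ℕ} {v : ℕ → Plane}

/-- The sharp bound for the product of the two area sums, with the equality case. -/
theorem sum_mul_sum_le (hv : IsSymmetricCycle m v) {N : ℕ} (hmN : m ≤ N) :
    (∑ i ∈ range m, planeDet (v i) (v (i + 1))) *
        (∑ i ∈ range m, planeDet (dualCycle v i) (dualCycle v (i + 1)))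
      ≤ (2 * N * Real.sin (Real.pi / (2 * N))) ^ 2 ∧
    ((2 * N * Real.sin (Real.pi / (2 * N))) ^ 2 ≤
      (∑ i ∈ range m, planeDet (v i) (v (i + 1))) *
        (∑ i ∈ range m, planeDet (dualCycle v i) (dualCycle v (i + 1))) →
      m = N ∧ ∃ s t s' t' : ℝ, ∀ i ≤ m,
        Real.cos (Real.pi * i / N) = s * v i 0 + t * v i 1 ∧
        Real.sin (Real.pi * i / N) = s' * v i 0 + t' * v i 1) := by
  have hm := hv.two_le
  set D : ℕ → ℝ := fun i => planeDet (v i) (v (i + 1)) with hD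
  set q : ℕ → ℝ := fun i => planeDet (dualCycle v i) (dualCycle v (i + 1)) with hq
  have hDpos : ∀ i, 0 < D i := hv.planeDet_succ_pos
  obtain ⟨c, hc0, hc1, hcsum⟩ := exists_scale_arcsin (m := m) (by omega) hDpos
  set ψ : ℕ → ℝ := fun i => Real.arcsin (c * D i) with hψ
  have hsin : ∀ i < m, Real.sin (ψ i) = c * D i := fun i hi =>
    Real.sin_arcsin (by have := mul_nonneg hc0 (hDpos i).le; linarith) (hc1 i hi)
  have hψmem : ∀ i < m, ψ i ∈ Set.Icc 0 Real.pi := fun i hi =>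
    ⟨Real.arcsin_nonneg.2 (mul_nonneg hc0 (hDpos i).le),
      (Real.arcsin_le_pi_div_two _).trans (by linarith [Real.pi_pos])⟩
  obtain ⟨hJ, hJeq⟩ := sum_sin_le (N := N) (by omega) hmN hψmem hcsum
  have hsumsin : ∑ i ∈ range m, Real.sin (ψ i) = c * ∑ i ∈ range m, D i := by
    rw [Finset.mul_sum]
    exact Finset.sum_congr rfl fun i hi => hsin i (Finset.mem_range.1 hi)
  set S := ∑ i ∈ range m, D i with hS
  have hSpos : 0 < S := Finset.sum_pos (fun i _ => hDpos i) ⟨0, Finset.mem_range.2 (by omega)⟩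
  -- Doubling makes θ run from 0 to π, so its cosine and sine are antiperiodic, while the chord of
  -- step `i` has length 2 sin ψ_i = 2c D_i.
  set θ : ℕ → ℝ := fun k => 2 * ∑ i ∈ range k, ψ i with hθ
  have hθ0 : θ 0 = 0 := by simp [hθ]
  have hθm : θ m = Real.pi := by simp only [hθ, hcsum]; ring
  obtain ⟨hcos, hcoseq⟩ := hv.wirtinger (f := fun i => Real.cos (θ i)) (by simp [hθ0, hθm])
  obtain ⟨hsn, hsneq⟩ := hv.wirtinger (f := fun i => Real.sin (θ i)) (by simp [hθ0, hθm])
  have htotal :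
      ∑ i ∈ range m, ((Real.cos (θ (i + 1)) - Real.cos (θ i)) ^ 2 / D i
        - q i * Real.cos (θ (i + 1)) ^ 2) +
      ∑ i ∈ range m, ((Real.sin (θ (i + 1)) - Real.sin (θ i)) ^ 2 / D i
        - q i * Real.sin (θ (i + 1)) ^ 2)
      = 4 * c ^ 2 * S - ∑ i ∈ range m, q i := by
    rw [← Finset.sum_add_distrib, hS, Finset.mul_sum, ← Finset.sum_sub_distrib]
    refine Finset.sum_congr rfl fun i hi => ?_
    have hstep : θ (i + 1) = θ i + 2 * ψ i := by
      simp only [hθ, Finset.sum_range_succ]; ring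
    have hchord : (Real.cos (θ (i + 1)) - Real.cos (θ i)) ^ 2
        + (Real.sin (θ (i + 1)) - Real.sin (θ i)) ^ 2 = 4 * (c * D i) ^ 2 := by
      rw [← hsin i (Finset.mem_range.1 hi), hstep, chord_sq]
    have h1 := Real.sin_sq_add_cos_sq (θ (i + 1))
    have hDi := (hDpos i).ne'
    calc _ = ((Real.cos (θ (i + 1)) - Real.cos (θ i)) ^ 2
          + (Real.sin (θ (i + 1)) - Real.sin (θ i)) ^ 2) / D i
          - q i * (Real.sin (θ (i + 1)) ^ 2 + Real.cos (θ (i + 1)) ^ 2) := by ring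
      _ = _ := by rw [hchord, h1]; field_simp
  set Q := ∑ i ∈ range m, q i with hQ
  have hQle : Q ≤ 4 * c ^ 2 * S := by
    have := add_nonneg hcos hsn
    change 0 ≤ ∑ i ∈ range m, ((Real.cos (θ (i + 1)) - Real.cos (θ i)) ^ 2 / D i
        - q i * Real.cos (θ (i + 1)) ^ 2) +
      ∑ i ∈ range m, ((Real.sin (θ (i + 1)) - Real.sin (θ i)) ^ 2 / D i
        - q i * Real.sin (θ (i + 1)) ^ 2) at this
    rw [htotal] at this
    linarith
  rw [hsumsin] at hJ hJeq
  have hcS : 0 ≤ c * S := mul_nonneg hc0 hSpos.le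
  have hSQ : S * Q ≤ (2 * (c * S)) ^ 2 := by
    calc S * Q ≤ S * (4 * c ^ 2 * S) := by gcongr
      _ = _ := by ring
  have hsq : (2 * (c * S)) ^ 2 ≤ (2 * (N * Real.sin (Real.pi / (2 * N)))) ^ 2 := by gcongr
  rw [mul_assoc 2 (N : ℝ)]
  refine ⟨hSQ.trans hsq, fun hge => ?_⟩
  have hge' : N * Real.sin (Real.pi / (2 * N)) ≤ c * S := by
    have := abs_le_of_sq_le_sq' (hge.trans hSQ) (by positivity)
    linarith [this.2]
  obtain ⟨hmeq, hψeq⟩ := hJeq hge'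
  have hQeq : Q = 4 * c ^ 2 * S := by
    refine le_antisymm hQle ?_
    have : S * (4 * c ^ 2 * S) ≤ S * Q := by
      calc S * (4 * c ^ 2 * S) = (2 * (c * S)) ^ 2 := by ring
        _ ≤ _ := hsq.trans hge
    exact le_of_mul_le_mul_left this hSpos
  -- Two nonnegative forms now add to zero, so both vanish and the equality case of `wirtinger`
  -- applies to cos θ and to sin θ.
  rw [hQeq, sub_self] at htotal
  obtain ⟨s, t, hst⟩ := hcoseq (le_antisymm (by
    have := hsn
    change 0 ≤ ∑ i ∈ range m, ((Real.sin (θ (i + 1)) - Real.sin (θ i)) ^ 2 / D i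
        - q i * Real.sin (θ (i + 1)) ^ 2) at this
    change ∑ i ∈ range m, ((Real.cos (θ (i + 1)) - Real.cos (θ i)) ^ 2 / D i
        - q i * Real.cos (θ (i + 1)) ^ 2) ≤ 0
    linarith) hcos)
  obtain ⟨s', t', hst'⟩ := hsneq (le_antisymm (by
    have := hcos
    change 0 ≤ ∑ i ∈ range m, ((Real.cos (θ (i + 1)) - Real.cos (θ i)) ^ 2 / D i
        - q i * Real.cos (θ (i + 1)) ^ 2) at this
    change ∑ i ∈ range m, ((Real.sin (θ (i + 1)) - Real.sin (θ i)) ^ 2 / D i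
        - q i * Real.sin (θ (i + 1)) ^ 2) ≤ 0
    linarith) hsn)
  have hθi : ∀ i ≤ m, θ i = Real.pi * i / N := by
    intro i hi
    simp only [hθ]
    rw [Finset.sum_congr rfl fun j hj => hψeq j ((Finset.mem_range.1 hj).trans_le hi),
      Finset.sum_const, Finset.card_range, nsmul_eq_mul]
    have : (N : ℝ) ≠ 0 := by
      have : 0 < N := by omega
      exact_mod_cast this.ne'
    field_simp
  refine ⟨hmeq, s, t, s', t', fun i hi => ?_⟩
  rw [← hθi i hi]
  exact ⟨hst i hi, hst' i hi⟩

end IsSymmetricCycle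

/-! ### The regular polygon -/

lemma planeDet_dualVertex_dualVertex (a b c d : Plane) :
    planeDet (dualVertex a b) (dualVertex c d) =
      (planeDet a c + planeDet b d - planeDet a d - planeDet b c) /
        (planeDet a b * planeDet c d) := by
  rw [dualVertex, dualVertex, planeDet_smul_left, planeDet_smul_right, div_eq_inv_mul, mul_inv,
    mul_assoc]
  simp [planeDet]; left; left; ring

/-- The vertices of a regular `2 * N`-gon. -/
noncomputable def regularVertex (N : ℕ) (r θ : ℝ) (k : ℕ) : Plane :=
  r • !₂[Real.cos (θ + Real.pi * k / N), Real.sin (θ + Real.pi * k / N)]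

section Regular

variable {N : ℕ} {r θ : ℝ}

lemma planeDet_regularVertex (i j : ℕ) :
    planeDet (regularVertex N r θ i) (regularVertex N r θ j)
      = r ^ 2 * Real.sin (((j : ℝ) - i) * (Real.pi / N)) := by
  have : ((j : ℝ) - i) * (Real.pi / N) = (θ + Real.pi * j / N) - (θ + Real.pi * i / N) := by ring
  rw [this, Real.sin_sub]
  simp [planeDet, regularVertex]; ring

lemma regularVertex_add (hN : N ≠ 0) (i : ℕ) :
    regularVertex N r θ (i + N) = -regularVertex N r θ i := by
  have hN' : (N : ℝ) ≠ 0 := by exact_mod_cast hN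
  have : θ + Real.pi * ((i + N : ℕ) : ℝ) / N = (θ + Real.pi * i / N) + Real.pi := by
    push_cast; field_simp; ring
  rw [regularVertex, this, Real.cos_add_pi, Real.sin_add_pi, regularVertex, ← smul_neg]
  congr 1
  ext i; fin_cases i <;> simp

lemma sin_natMul_pos {x : ℝ} (hN : N ≠ 0) (h0 : 0 < x) (h1 : x < N) :
    0 < Real.sin (x * (Real.pi / N)) := by
  have hN' : (0 : ℝ) < N := by exact_mod_cast Nat.pos_of_ne_zero hN
  have hpi := Real.pi_pos
  refine Real.sin_pos_of_pos_of_lt_pi (by positivity) ?_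
  calc x * (Real.pi / N) < N * (Real.pi / N) := by gcongr
    _ = Real.pi := by field_simp

lemma isSymmetricCycle_regularVertex (hN : 2 ≤ N) (hr : 0 < r) :
    IsSymmetricCycle N (regularVertex N r θ) := by
  refine ⟨hN, regularVertex_add (by omega), fun i j hij hj => ?_⟩
  rw [planeDet_regularVertex]
  have h1 : (i : ℝ) < j := by exact_mod_cast hij
  have h2 : (j : ℝ) < i + N := by exact_mod_cast hj
  have := sin_natMul_pos (N := N) (x := (j : ℝ) - i) (by omega) (by linarith) (by linarith)
  positivity

lemma planeDet_dual_regularVertex (hN : 2 ≤ N) (hr : 0 < r) (i j : ℕ) :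
    planeDet (dualCycle (regularVertex N r θ) i) (dualCycle (regularVertex N r θ) j)
      = 2 * Real.sin (((j : ℝ) - i) * (Real.pi / N)) * (1 - Real.cos (Real.pi / N))
        / (r ^ 2 * Real.sin (Real.pi / N) ^ 2) := by
  set t := Real.pi / N with ht
  have hsin : 0 < Real.sin t := by
    have := sin_natMul_pos (N := N) (x := 1) (by omega) one_pos (by exact_mod_cast hN)
    rwa [one_mul] at this
  rw [dualCycle, dualCycle, planeDet_dualVertex_dualVertex]
  simp only [planeDet_regularVertex, ← ht]
  push_cast
  rw [show ((j : ℝ) + 1 - (i + 1)) * t = (j - i) * t by ring,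
    show ((j : ℝ) + 1 - i) * t = (j - i) * t + t by ring,
    show ((j : ℝ) - (i + 1)) * t = (j - i) * t - t by ring,
    show ((i : ℝ) + 1 - i) * t = t by ring, show ((j : ℝ) + 1 - j) * t = t by ring,
    Real.sin_add, Real.sin_sub]
  field_simp
  ring

lemma cos_pi_div_lt_one (hN : 2 ≤ N) : Real.cos (Real.pi / N) < 1 := by
  have hN' : (2 : ℝ) ≤ N := by exact_mod_cast hN
  have hpi := Real.pi_pos
  have := Real.cos_lt_cos_of_nonneg_of_le_pi (x := 0) (y := Real.pi / N) le_rfl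
    (div_le_self hpi.le (by linarith)) (by positivity)
  simpa using this

lemma isSymmetricCycle_dual_regularVertex (hN : 2 ≤ N) (hr : 0 < r) :
    IsSymmetricCycle N (dualCycle (regularVertex N r θ)) := by
  have hv := isSymmetricCycle_regularVertex (θ := θ) hN hr
  refine ⟨hN, hv.dual_anti, fun i j hij hj => ?_⟩
  rw [planeDet_dual_regularVertex hN hr]
  have h1 : (i : ℝ) < j := by exact_mod_cast hij
  have h2 : (j : ℝ) < i + N := by exact_mod_cast hj
  have h3 := sin_natMul_pos (N := N) (x := (j : ℝ) - i) (by omega) (by linarith) (by linarith)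
  have h4 := sin_natMul_pos (N := N) (x := 1) (by omega) one_pos (by exact_mod_cast hN)
  rw [one_mul] at h4
  have h5 := sub_pos.2 (cos_pi_div_lt_one hN)
  positivity

lemma regular_sum_mul_sum (hN : 2 ≤ N) (hr : 0 < r) :
    (∑ i ∈ range N, planeDet (regularVertex N r θ i) (regularVertex N r θ (i + 1))) *
      (∑ i ∈ range N, planeDet (dualCycle (regularVertex N r θ) i)
        (dualCycle (regularVertex N r θ) (i + 1)))
      = (2 * N * Real.sin (Real.pi / (2 * N))) ^ 2 := by
  have h4 := sin_natMul_pos (N := N) (x := 1) (by omega) one_pos (by exact_mod_cast hN)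
  rw [one_mul] at h4
  simp only [planeDet_dual_regularVertex hN hr, planeDet_regularVertex]
  push_cast
  simp only [add_sub_cancel_left, one_mul, Finset.sum_const, Finset.card_range, nsmul_eq_mul]
  have hhalf : Real.pi / N = 2 * (Real.pi / (2 * N)) := by ring
  have hcos : Real.cos (Real.pi / N) = 1 - 2 * Real.sin (Real.pi / (2 * N)) ^ 2 := by
    rw [hhalf, Real.cos_two_mul, Real.cos_sq']; ring
  rw [hcos]
  field_simp
  ring

/-- Factors the defect in `regular_cone_sum_le` so that its sign can be read off. -/
lemma sin_sub_sin_add_sin (d t : ℝ) :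
    Real.sin t - Real.sin (d * t) + Real.sin ((d - 1) * t)
      = 4 * Real.sin (t / 2) * Real.sin (d * (t / 2)) * Real.sin ((d - 1) * (t / 2)) := by
  have e1 : d * t = 2 * (d * (t / 2)) := by ring
  have e2 : (d - 1) * t = 2 * (d * (t / 2) - t / 2) := by ring
  have e3 : (d - 1) * (t / 2) = d * (t / 2) - t / 2 := by ring
  have e4 : Real.sin t = 2 * Real.sin (t / 2) * Real.cos (t / 2) := by
    rw [← Real.sin_two_mul]; congr 1; ring
  rw [e1, e2, e3, e4]
  set x := d * (t / 2)
  set y := t / 2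
  rw [Real.sin_two_mul, Real.sin_two_mul, Real.sin_sub, Real.cos_sub]
  have hx := Real.sin_sq_add_cos_sq x
  have hy := Real.sin_sq_add_cos_sq y
  linear_combination (2 * Real.sin y * Real.cos y) * hx * (-1)
    + (2 * Real.sin x * Real.cos x) * hy

lemma regular_cone_sum_le (hN : 2 ≤ N) (hr : 0 < r) (i j : ℕ) :
    planeDet (regularVertex N r θ i) (regularVertex N r θ j)
      + planeDet (regularVertex N r θ j) (regularVertex N r θ (i + 1))
      ≤ planeDet (regularVertex N r θ i) (regularVertex N r θ (i + 1)) := by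
  -- A representative between `i + 1` and `i + 2 * N` keeps all three half-angles in [0, π].
  obtain ⟨k, hk1, hk2, hkj⟩ := (isSymmetricCycle_regularVertex (θ := θ) hN hr).exists_index (i + 1) j
  rw [← hkj]
  simp only [planeDet_regularVertex]
  have hN' : (2 : ℝ) ≤ N := by exact_mod_cast hN
  have hpi := Real.pi_pos
  have h1 : (i : ℝ) + 1 ≤ k := by exact_mod_cast hk1
  have h2 : (k : ℝ) ≤ i + 2 * N := by
    have : k ≤ i + 2 * N := by omega
    exact_mod_cast this
  have key := sin_sub_sin_add_sin ((k : ℝ) - i) (Real.pi / N)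
  have hnn : ∀ x : ℝ, 0 ≤ x → x ≤ 2 * N → 0 ≤ Real.sin (x * (Real.pi / N / 2)) := by
    intro x hx hx'
    refine Real.sin_nonneg_of_nonneg_of_le_pi (by positivity) ?_
    calc x * (Real.pi / N / 2) ≤ 2 * N * (Real.pi / N / 2) := by gcongr
      _ = Real.pi := by field_simp
  have a1 := hnn 1 zero_le_one (by linarith)
  have a2 := hnn (k - i) (by linarith) (by linarith)
  have a3 := hnn (k - i - 1) (by linarith) (by linarith)
  rw [one_mul] at a1
  have hge : 0 ≤ 4 * Real.sin (Real.pi / N / 2) * Real.sin (((k : ℝ) - i) * (Real.pi / N / 2))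
      * Real.sin (((k : ℝ) - i - 1) * (Real.pi / N / 2)) := by positivity
  rw [← key] at hge
  push_cast
  rw [show ((i : ℝ) + 1 - k) * (Real.pi / N) = -((k - i - 1) * (Real.pi / N)) by ring,
    Real.sin_neg, show ((i : ℝ) + 1 - i) * (Real.pi / N) = Real.pi / N by ring]
  nlinarith [mul_nonneg (sq_nonneg r) hge]

lemma convex_polarBody (K : Set Plane) : Convex ℝ (polarBody K) := by
  intro y hy z hz s t hs ht hst x hx
  rw [inner_add_right, inner_smul_right, inner_smul_right]
  calc s * inner ℝ x y + t * inner ℝ x z ≤ s * 1 + t * 1 := by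
        gcongr
        · exact hy x hx
        · exact hz x hx
    _ = 1 := by rw [mul_one, mul_one, hst]

/-- The dual vertices lie in the polar because `regular_cone_sum_le` bounds their pairings with all
vertices by 1, so `sum_le_volume` applies to both bodies. -/
lemma le_volume_regular (hN : 2 ≤ N) (hr : 0 < r) :
    ENNReal.ofReal ((2 * N * Real.sin (Real.pi / (2 * N))) ^ 2) ≤
      volume (convexHull ℝ (Set.range (regularVertex N r θ))) *
        volume (polarBody (convexHull ℝ (Set.range (regularVertex N r θ)))) := by
  have hv := isSymmetricCycle_regularVertex (θ := θ) hN hr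
  have hw := isSymmetricCycle_dual_regularVertex (θ := θ) hN hr
  rw [← regular_sum_mul_sum (θ := θ) hN hr, ENNReal.ofReal_mul
    (Finset.sum_nonneg fun i _ => (hv.planeDet_succ_pos i).le)]
  have hmem : ∀ i, regularVertex N r θ i ∈ convexHull ℝ (Set.range (regularVertex N r θ)) :=
    fun i => subset_convexHull ℝ _ (Set.mem_range_self i)
  refine mul_le_mul' (hv.sum_le_volume (convex_convexHull ℝ _) ?_ hmem)
    (hw.sum_le_volume (convex_polarBody _) ?_ ?_)
  · have h := convex_convexHull ℝ (Set.range (regularVertex N r θ)) (hmem 0) (hmem (0 + N))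
      (a := 1 / 2) (b := 1 / 2) (by norm_num) (by norm_num) (by norm_num)
    rw [hv.anti] at h
    simpa using h
  · intro x _; simp
  · intro i x hx
    have hpos := hv.planeDet_succ_pos i
    have hsub : convexHull ℝ (Set.range (regularVertex N r θ)) ⊆
        {x | inner ℝ x (dualCycle (regularVertex N r θ) i) ≤ 1} := by
      refine convexHull_min ?_ ?_
      · rintro _ ⟨j, rfl⟩
        rw [Set.mem_ofPred_eq, dualCycle, inner_dualVertex, div_le_one hpos]
        exact regular_cone_sum_le hN hr i j
      · intro x hx y hy s t hs ht hst
        simp only [Set.mem_ofPred_eq] at hx hy ⊢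
        rw [inner_add_left, real_inner_smul_left, real_inner_smul_left]
        calc _ ≤ s * 1 + t * 1 := by gcongr
          _ = 1 := by rw [mul_one, mul_one, hst]
    exact hsub hx

lemma range_eq_range_fin {α : Type*} (f : ℕ → α) (n : ℕ) (hn : 0 < n) (hf : ∀ i, f (i + n) = f i) :
    Set.range (fun k : Fin n => f k) = Set.range f := by
  refine Set.Subset.antisymm (by rintro _ ⟨k, rfl⟩; exact ⟨k, rfl⟩) ?_
  rintro _ ⟨k, rfl⟩
  refine ⟨⟨k % n, Nat.mod_lt _ hn⟩, ?_⟩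
  exact (Function.Periodic.map_mod_nat hf k)

lemma range_regular (hN : 2 ≤ N) (c : Plane) :
    Set.range (fun k : Fin (2 * N) =>
      c + r • !₂[Real.cos (θ + 2 * Real.pi * (k : ℝ) / ((2 * N : ℕ) : ℝ)),
                 Real.sin (θ + 2 * Real.pi * (k : ℝ) / ((2 * N : ℕ) : ℝ))])
      = (fun x => c + x) '' Set.range (regularVertex N r θ) := by
  rw [← range_eq_range_fin (regularVertex N r θ) (2 * N) (by omega), ← Set.range_comp]
  · congr 1
    ext1 k
    have : θ + 2 * Real.pi * (k : ℝ) / ((2 * N : ℕ) : ℝ) = θ + Real.pi * k / N := by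
      push_cast
      rw [mul_assoc, mul_div_mul_left _ _ two_ne_zero]
    simp only [Function.comp, regularVertex, this]
  · intro i
    rw [show i + 2 * N = i + N + N by ring, regularVertex_add (by omega),
      regularVertex_add (by omega), neg_neg]

lemma neg_range_regularVertex (hN : 2 ≤ N) {x : Plane}
    (hx : x ∈ convexHull ℝ (Set.range (regularVertex N r θ))) :
    -x ∈ convexHull ℝ (Set.range (regularVertex N r θ)) := by
  have hsub : -Set.range (regularVertex N r θ) ⊆ Set.range (regularVertex N r θ) := by
    rintro x ⟨k, hk⟩
    exact ⟨k + N, by rw [regularVertex_add (by omega), hk, neg_neg]⟩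
  have : -x ∈ -convexHull ℝ (Set.range (regularVertex N r θ)) := Set.neg_mem_neg.2 hx
  rw [← convexHull_neg] at this
  exact convexHull_mono hsub this

/-- Composing the reflections in the origin and in `c` gives the translation by `2c`, which maps the
bounded set `Q` into itself. -/
lemma center_eq_zero {Q : Set Plane} (hQ : Bornology.IsBounded Q) (hne : Q.Nonempty)
    (hneg : ∀ x ∈ Q, -x ∈ Q) {c : Plane} (hc : ∀ x ∈ Q, -(c + x) ∈ (fun x => c + x) '' Q) :
    c = 0 := by
  have hstep : ∀ x ∈ Q, x + (2 : ℝ) • c ∈ Q := by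
    intro x hx
    obtain ⟨y, hy, hxy⟩ := hc x hx
    have : x + (2 : ℝ) • c = -y := by
      rw [two_smul]
      have hy' : y = -(c + x) - c := by simp only at hxy; rw [← hxy]; abel
      rw [hy']; abel
    rw [this]; exact hneg y hy
  obtain ⟨x, hx⟩ := hne
  have hiter : ∀ k : ℕ, x + (2 * k : ℝ) • c ∈ Q := by
    intro k
    induction k with
    | zero => simpa using hx
    | succ k ih =>
      have := hstep _ ih
      rw [add_assoc, ← add_smul] at this
      push_cast
      rwa [mul_add, mul_one]
  obtain ⟨R, hR⟩ := hQ.exists_norm_le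
  by_contra hc0
  have hcpos : 0 < ‖c‖ := norm_pos_iff.2 hc0
  obtain ⟨k, hk⟩ := exists_nat_gt ((R + ‖x‖) / ‖c‖)
  rw [div_lt_iff₀ hcpos] at hk
  have h1 := hR _ (hiter k)
  have h2 : ‖(2 * k : ℝ) • c‖ ≤ ‖x + (2 * k : ℝ) • c‖ + ‖x‖ := by
    have := norm_sub_le (x + (2 * k : ℝ) • c) x
    rwa [add_sub_cancel_left] at this
  rw [norm_smul, Real.norm_of_nonneg (by positivity)] at h2
  nlinarith [mul_nonneg (Nat.cast_nonneg (α := ℝ) k) hcpos.le]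

end Regular

/-! ### Linear invariance and the equality case -/

lemma polarBody_image (A : Plane ≃ₗ[ℝ] Plane) (P : Set Plane) :
    polarBody (A '' P) = LinearMap.adjoint (A : Plane →ₗ[ℝ] Plane) ⁻¹' polarBody P := by
  ext y
  simp only [polarBody, Set.mem_preimage, Set.mem_ofPred_eq, Set.forall_mem_image,
    LinearMap.adjoint_inner_right]
  rfl

/-- The polar transforms by the inverse adjoint, so the two determinant factors cancel. -/
lemma volume_image_mul_volume_polarBody (A : Plane ≃ₗ[ℝ] Plane) (P : Set Plane) :
    volume (A '' P) * volume (polarBody (A '' P)) = volume P * volume (polarBody P) := by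
  have hdet : LinearMap.det (A : Plane →ₗ[ℝ] Plane) ≠ 0 := A.isUnit_det'.ne_zero
  have hadj : LinearMap.det (LinearMap.adjoint (A : Plane →ₗ[ℝ] Plane))
      = LinearMap.det (A : Plane →ₗ[ℝ] Plane) := by
    have h := LinearMap.toMatrix_adjoint (EuclideanSpace.basisFun (Fin 2) ℝ)
      (EuclideanSpace.basisFun (Fin 2) ℝ) (A : Plane →ₗ[ℝ] Plane)
    rw [← LinearMap.det_toMatrix (EuclideanSpace.basisFun (Fin 2) ℝ).toBasis, h,
      Matrix.det_conjTranspose, LinearMap.det_toMatrix, star_trivial]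
  have himg := Measure.addHaar_image_linearMap (volume : Measure Plane) (A : Plane →ₗ[ℝ] Plane) P
  simp only [LinearEquiv.coe_coe] at himg
  rw [polarBody_image, Measure.addHaar_preimage_linearMap _ (by rwa [hadj]), hadj, himg,
    mul_mul_mul_comm, ← ENNReal.ofReal_mul (abs_nonneg _), abs_inv,
    mul_inv_cancel₀ (abs_ne_zero.2 hdet), ENNReal.ofReal_one, one_mul]

lemma planeDet_frameMap (p q a b : Plane) :
    planeDet (frameMap p q a) (frameMap p q b) = planeDet p q * planeDet a b := by
  simp only [frameMap_apply, planeDet, PiLp.add_apply, PiLp.smul_apply, smul_eq_mul]; ring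

lemma isRegularPolygon_regularVertex {N : ℕ} (hN : 2 ≤ N) :
    IsRegularPolygon (2 * N) (convexHull ℝ (Set.range (regularVertex N 1 0))) := by
  refine ⟨by omega, 0, 1, 0, one_pos, ?_⟩
  rw [range_regular hN]
  simp

namespace IsSymmetricCycle

variable {N : ℕ} {v : ℕ → Plane}

/-- A cycle that a linear map sends to a regular polygon spans a linear image of it. -/
lemma exists_regular_of_linear (hv : IsSymmetricCycle N v) {s t s' t' : ℝ}
    (h : ∀ i ≤ N, Real.cos (Real.pi * i / N) = s * v i 0 + t * v i 1 ∧
        Real.sin (Real.pi * i / N) = s' * v i 0 + t' * v i 1) :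
    ∃ A : Plane ≃ₗ[ℝ] Plane,
      convexHull ℝ (Set.range v) = A '' convexHull ℝ (Set.range (regularVertex N 1 0)) := by
  have hN := hv.two_le
  have hreg := isSymmetricCycle_regularVertex (r := 1) (θ := 0) hN one_pos
  -- The columns are chosen so that the coordinates of `B x` are the two given functionals. `B` is
  -- invertible because the image cycle has nonzero determinants.
  set B := frameMap !₂[s, s'] !₂[t, t'] with hB
  have hBlt : ∀ i ≤ N, B (v i) = regularVertex N 1 0 i := by
    intro i hi
    obtain ⟨h1, h2⟩ := h i hi
    rw [hB, frameMap_apply]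
    ext j
    fin_cases j
    · simp [regularVertex, h1]; ring
    · simp [regularVertex, h2]; ring
  have hBv : ∀ i, B (v i) = regularVertex N 1 0 i := by
    intro i
    induction i using Nat.strong_induction_on with
    | _ i ih =>
      rcases le_or_gt i N with hi | hi
      · exact hBlt i hi
      · obtain ⟨k, rfl⟩ : ∃ k, i = k + N := ⟨i - N, by omega⟩
        rw [hv.anti, hreg.anti, map_neg, ih k (by omega)]
  have hdet : LinearMap.det B ≠ 0 := by
    rw [hB, det_frameMap]
    intro h0
    have h1 := hreg.planeDet_succ_pos 0
    rw [← hBv, ← hBv, hB, planeDet_frameMap, h0, zero_mul] at h1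
    exact lt_irrefl _ h1
  set e := LinearMap.equivOfDetNeZero B hdet with he
  have hev : ∀ i, e (v i) = regularVertex N 1 0 i := hBv
  refine ⟨e.symm, ?_⟩
  have himg := LinearMap.image_convexHull (e.symm : Plane →ₗ[ℝ] Plane)
    (Set.range (regularVertex N 1 0))
  simp only [LinearEquiv.coe_coe] at himg
  rw [himg, ← Set.range_comp]
  congr 2
  ext1 i
  simp [← hev]

end IsSymmetricCycle

/-- A regular polygon may have any centre, but symmetry of its linear image makes it symmetric
itself, which forces the centre to be the origin. -/
lemma regular_image_bound {N : ℕ} (hN : 2 ≤ N) {P : Set Plane} {A : Plane ≃ₗ[ℝ] Plane}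
    (hP : IsRegularPolygon (2 * N) P) (hsymm : IsOriginSymmetric (A '' P)) :
    ENNReal.ofReal ((2 * N * Real.sin (Real.pi / (2 * N))) ^ 2) ≤
      volume (A '' P) * volume (polarBody (A '' P)) := by
  obtain ⟨-, c, r, θ, hr, hPc⟩ := hP
  rw [range_regular hN] at hPc
  set Q := convexHull ℝ (Set.range (regularVertex N r θ)) with hQ
  have hPQ : P = (fun x => c + x) '' Q := by
    rw [hPc, hQ]
    have := convexHull_vadd (𝕜 := ℝ) c (Set.range (regularVertex N r θ))
    exact this
  have hPneg : ∀ x ∈ P, -x ∈ P := by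
    intro x hx
    obtain ⟨y, hy, hxy⟩ := hsymm (A x) (Set.mem_image_of_mem A hx)
    rw [← map_neg] at hxy
    rwa [← A.injective hxy]
  have hfin : (Set.range (regularVertex N r θ)).Finite := by
    rw [← range_eq_range_fin (regularVertex N r θ) (2 * N) (by omega)]
    · exact Set.finite_range _
    · intro i
      rw [show i + 2 * N = i + N + N by ring, regularVertex_add (by omega),
        regularVertex_add (by omega), neg_neg]
  have hc : c = 0 := by
    refine center_eq_zero (Q := Q) (hfin.isCompact_convexHull ℝ).isBounded
      ((Set.range_nonempty _).convexHull) (fun x hx => neg_range_regularVertex hN hx) ?_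
    intro x hx
    rw [← hPQ]
    exact hPneg _ (hPQ ▸ Set.mem_image_of_mem _ hx)
  have hPQ' : P = Q := by rw [hPQ, hc]; simp
  rw [volume_image_mul_volume_polarBody, hPQ']
  exact le_volume_regular hN hr

theorem theoremA (n : ℕ) (hn : 6 ≤ n) (hn_even : Even n)
    (K : Set (EuclideanSpace ℝ (Fin 2)))
    (hK : IsConvexPolygon K) (hK_symm : IsOriginSymmetric K)
    (hK_vert : (polygonVertices K).encard ≤ n) :
    MeasureTheory.volume K * MeasureTheory.volume (polarBody K) ≤
        ENNReal.ofReal ((n : ℝ) ^ 2 * Real.sin (Real.pi / (n : ℝ)) ^ 2) ∧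
      (MeasureTheory.volume K * MeasureTheory.volume (polarBody K) =
          ENNReal.ofReal ((n : ℝ) ^ 2 * Real.sin (Real.pi / (n : ℝ)) ^ 2) ↔
        ∃ (A : EuclideanSpace ℝ (Fin 2) ≃ₗ[ℝ] EuclideanSpace ℝ (Fin 2))
          (P : Set (EuclideanSpace ℝ (Fin 2))), IsRegularPolygon n P ∧ K = A '' P) := by
  obtain ⟨N, rfl⟩ : ∃ N, n = 2 * N := hn_even.exists_two_nsmul _ |>.imp fun _ h => by simpa using h
  have hN : 2 ≤ N := by omega
  have hbound : ((2 * N : ℕ) : ℝ) ^ 2 * Real.sin (Real.pi / ((2 * N : ℕ) : ℝ)) ^ 2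
      = (2 * N * Real.sin (Real.pi / (2 * N))) ^ 2 := by push_cast; ring
  rw [hbound]
  obtain ⟨hfin, hull⟩ := convexPolygon_eq_hull hK
  have hint := hK.2
  have hconv : Convex ℝ K := by rw [hull]; exact convex_convexHull ℝ _
  obtain ⟨m, v, hv, hr⟩ := exists_cycle_range_eq hconv hK_symm hint hfin hull
  have hmN : m ≤ N := by
    have h := hv.two_mul_le_encard_range
    rw [hr] at h
    have : ((2 * m : ℕ) : ℕ∞) ≤ ((2 * N : ℕ) : ℕ∞) := h.trans hK_vert
    have : 2 * m ≤ 2 * N := by exact_mod_cast this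
    omega
  obtain ⟨hle, heq⟩ := hv.sum_mul_sum_le hmN
  have hvol := mul_le_mul' (hv.volume_hull_le hr hconv hK_symm hint hull)
    (hv.volume_polar_le hr hconv hK_symm hint)
  rw [← ENNReal.ofReal_mul (Finset.sum_nonneg fun i _ => (hv.planeDet_succ_pos i).le)] at hvol
  have hupper := hvol.trans (ENNReal.ofReal_le_ofReal hle)
  refine ⟨hupper, fun h => ?_, ?_⟩
  · rw [h] at hvol
    have hnn : 0 ≤ (∑ i ∈ range m, planeDet (v i) (v (i + 1))) *
        ∑ i ∈ range m, planeDet (dualCycle v i) (dualCycle v (i + 1)) :=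
      mul_nonneg (Finset.sum_nonneg fun i _ => (hv.planeDet_succ_pos i).le)
        (Finset.sum_nonneg fun i _ => (hv.dual_planeDet_pos hr hconv hK_symm hint i).le)
    obtain ⟨rfl, s, t, s', t', hlin⟩ := heq ((ENNReal.ofReal_le_ofReal_iff hnn).1 hvol)
    obtain ⟨A, hA⟩ := hv.exists_regular_of_linear hlin
    refine ⟨A, _, isRegularPolygon_regularVertex hN, ?_⟩
    rw [← hA, hr]
    exact hull
  · rintro ⟨A, P, hP, rfl⟩
    exact le_antisymm hupper (regular_image_bound hN hP hK_symm)
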